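/- Conventions. Write $2^{<\mathbb N}$ for the finite binary strings, $\Lambda$ for the empty string, and $\sigma\prec X$ when $\sigma$ is a prefix of $X\in 2^{\mathbb N}$. A $\Pi^0_1$ class is a set of the form $\{X\in2^{\mathbb N} : \sigma\not\prec X \text{ for all } \sigma\in S\}$ with $S\subseteq 2^{<\mathbb N}$ computably enumerable. The canonical tree of $\mathcal C\subseteq 2^{\mathbb N}$ is $T=\{\sigma : \sigma\prec X \text{ for some } X\in\mathcal C\}$, and $T_n$ is the set of its strings of length $n$. A continuous semi-measure is a function $\rho:2^{<\mathbb N}\to[0,1]$ with $\rho(\Lambda)=1$ and $\rho(\sigma)\ge\rho(\sigma0)+\rho(\sigma1)$ for all $\sigma$; it is lower semi-computable if it is the pointwise limit of a (uniformly) computable non-decreasing sequence of dyadic-rational-valued functions. It is a universal lower semi-computable continuous semi-measure if, moreover, for every lower semi-computable continuous semi-measure $\rho'$ there is $c\in\mathbb N$ with $\rho'\le c\cdot\rho$. Fix such a universal $\mathbf M$, and put $\mathbf M(S)=\sum_{\sigma\in S}\mathbf M(\sigma)$. A class $\mathcal C\subseteq 2^{\mathbb N}$ with canonical tree $T$ is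 deep if there is a computable, non-decreasing, unbounded $h:\mathbb N\to\mathbb N$ with $\mathbf M(T_n)\le 2^{-h(n)}$ for all $n$. Theorem. Let $(\phi_e)_{e\in\mathbb N}$ be a uniformly partial computable enumeration of all $\{0,1\}$-valued partial computable functions, and let $u$ be a partial computable $\{0,1\}$-valued function that is universal for it: for some computable $g:\mathbb N^2\to\mathbb N$, $u(g(e,x))\simeq\phi_e(x)$ for all $e,x$ (for example, $u(\langle e,x\rangle)\simeq\phi_e(x)$). Then the class $\mathcal C$ of total $\{0,1\}$-valued functions that extend $u$ is a $\Pi^0_1$ class, and it is deep. Furthermore, the class of consistent completions of first-order Peano arithmetic (that is, of complete consistent theories containing its axioms, each identified with the characteristic function of its set of Gödel numbers) is deep. -/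

import Mathlib

namespace DeepClass

/-! ### Strings, sequences, effectively closed classes -/

/-- The string `σ` is a prefix of the infinite binary sequence `X`. -/
def IsPrefixOf (σ : List Bool) (X : ℕ → Bool) : Prop :=
  ∀ (i : ℕ) (h : i < σ.length), σ[i] = X i

/-- Effectively closed classes: complements of unions of cylinders over a c.e. set of strings. -/
def IsPi01Class (C : Set (ℕ → Bool)) : Prop :=
  ∃ S : Set (List Bool), REPred (fun σ => σ ∈ S) ∧
    C = {X | ∃ σ ∈ S, IsPrefixOf σ X}ᶜ

/-- The canonical tree of `C`: all prefixes of members of `C`. -/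
def canonicalTree (C : Set (ℕ → Bool)) : Set (List Bool) :=
  {σ | ∃ X ∈ C, IsPrefixOf σ X}

/-- The set of members of length `n` of a set of strings. -/
def level (T : Set (List Bool)) (n : ℕ) : Set (List Bool) :=
  {σ | σ ∈ T ∧ σ.length = n}

theorem level_finite (T : Set (List Bool)) (n : ℕ) : (level T n).Finite :=
  (List.finite_length_eq Bool n).subset fun _ h => h.2

/-! ### Lower semi-computable continuous semi-measures -/

/-- Continuous semi-measures on finite binary strings. -/
structure IsContinuousSemimeasure (ρ : List Bool → ℝ) : Prop where
  mem_Icc : ∀ σ, ρ σ ∈ Set.Icc (0 : ℝ) 1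
  root : ρ [] = 1
  split : ∀ σ, ρ (σ ++ [false]) + ρ (σ ++ [true]) ≤ ρ σ

/-- A nonnegative function on strings is lower semi-computable if it is the pointwise limit of a
computable non-decreasing sequence of (nonnegative) dyadic rationals; the pair `(a, b)` stands
for the dyadic rational `a / 2 ^ b`. -/
def IsLowerSemicomputable (ρ : List Bool → ℝ) : Prop :=
  ∃ q : List Bool → ℕ → ℕ × ℕ, Computable₂ q ∧
    ∀ σ, Monotone (fun s => ((q σ s).1 : ℝ) / 2 ^ (q σ s).2) ∧
      Filter.Tendsto (fun s => ((q σ s).1 : ℝ) / 2 ^ (q σ s).2) Filter.atTop (nhds (ρ σ))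

/-- `M` is a universal lower semi-computable continuous semi-measure: it is one, and it dominates
every other one up to a multiplicative constant. -/
structure IsUniversalSemimeasure (M : List Bool → ℝ) : Prop where
  semimeasure : IsContinuousSemimeasure M
  lowerSemicomputable : IsLowerSemicomputable M
  universal : ∀ ρ : List Bool → ℝ, IsContinuousSemimeasure ρ → IsLowerSemicomputable ρ →
    ∃ c : ℕ, ∀ σ, ρ σ ≤ c * M σ

/-- The weight `ρ(S)`, the sum of `ρ` over a (finite) set `S` of strings. -/
noncomputable def weight (ρ : List Bool → ℝ) (S : Set (List Bool)) : ℝ :=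
  ∑ᶠ σ ∈ S, ρ σ

/-! ### Depth -/

/-- Computable order functions. -/
structure IsComputableOrder (h : ℕ → ℕ) : Prop where
  computable : Computable h
  monotone : Monotone h
  unbounded : ∀ k, ∃ n, k ≤ h n

/-- Depth of a class with respect to `M`: the weight of the `n`-th level of its canonical tree
is at most `2 ^ (-h n)` for some computable order `h`. -/
def IsDeep (M : List Bool → ℝ) (C : Set (ℕ → Bool)) : Prop :=
  ∃ h : ℕ → ℕ, IsComputableOrder h ∧
    ∀ n, weight M (level (canonicalTree C) n) ≤ (1 / 2 : ℝ) ^ h n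

/-! ### Universal partial computable `{0,1}`-valued functions -/

/-- `φ` is an effective (uniformly partial computable) enumeration of all partial computable
`{0,1}`-valued functions. -/
structure IsEffectiveEnumeration (φ : ℕ → ℕ →. Bool) : Prop where
  partrec : Partrec₂ φ
  exhaustive : ∀ ψ : ℕ →. Bool, Partrec ψ → ∃ e, φ e = ψ

/-- `u` is a partial computable function universal for the family `φ`: it computes `φ e x` from a
computable code of the pair `(e, x)`. The code `Nat.pair e x` is the basic example. -/
structure IsUniversalFor (u : ℕ →. Bool) (φ : ℕ → ℕ →. Bool) : Prop where
  partrec : Partrec u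
  simulates : ∃ g : ℕ → ℕ → ℕ, Computable₂ g ∧ ∀ e x, u (g e x) = φ e x

/-- The class of total `{0,1}`-valued extensions of `u`. -/
def totalExtensions (u : ℕ →. Bool) : Set (ℕ → Bool) :=
  {X | ∀ n, ∀ b ∈ u n, X n = b}

/-! ### Peano arithmetic -/

open FirstOrder FirstOrder.Language

/-- Function symbols of arithmetic. -/
inductive ArithFunc : ℕ → Type
  | zero : ArithFunc 0
  | succ : ArithFunc 1
  | add : ArithFunc 2
  | mul : ArithFunc 2

/-- The language `0, S, +, ·` of arithmetic (with equality). -/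
abbrev arith : FirstOrder.Language.{0, 0} := ⟨ArithFunc, fun _ => Empty⟩

section Terms

variable {α : Type}

def tZero : arith.Term α := Term.func (L := arith) ArithFunc.zero ![]
def tSucc (t : arith.Term α) : arith.Term α := Term.func (L := arith) ArithFunc.succ ![t]
def tAdd (t s : arith.Term α) : arith.Term α := Term.func (L := arith) ArithFunc.add ![t, s]
def tMul (t s : arith.Term α) : arith.Term α := Term.func (L := arith) ArithFunc.mul ![t, s]

end Terms

/-- The universal closure of a formula in the variables `0, …, n - 1`. -/
def closure {n : ℕ} (φ : arith.Formula (Fin n)) : arith.Sentence :=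
  BoundedFormula.alls (n := n) (BoundedFormula.relabel (Sum.inr : Fin n → Empty ⊕ Fin n) φ)

/-- `φ(x₀, …, xₙ₋₁, t)` for a formula `φ` in the variables `0, …, n`. -/
def substLast {n m : ℕ} (φ : arith.Formula (Fin (n + 1))) (v : Fin n → Fin m)
    (t : arith.Term (Fin m)) : arith.Formula (Fin m) :=
  BoundedFormula.subst φ (Fin.snoc (α := fun _ => arith.Term (Fin m)) (fun i => Term.var (v i)) t)

/-- `∀ xₙ, φ(x₀, …, xₙ)` for a formula `φ` in the variables `0, …, n`. -/
def allLast {n : ℕ} (φ : arith.Formula (Fin (n + 1))) : arith.Formula (Fin n) :=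
  BoundedFormula.all (n := 0) (BoundedFormula.relabel (n := 1) (k := 0)
    (Fin.snoc (α := fun _ => Fin n ⊕ Fin 1) Sum.inl (Sum.inr 0)) φ)

/-- The induction axiom for `φ`, on its last variable, with the other variables as parameters:
the universal closure of `φ(0) → (∀ x, φ(x) → φ(S x)) → ∀ x, φ(x)`. -/
def inductionAxiom {n : ℕ} (φ : arith.Formula (Fin (n + 1))) : arith.Sentence :=
  closure <|
    (substLast φ id tZero).imp <|
      (allLast (φ.imp (substLast φ Fin.castSucc (tSucc (Term.var (Fin.last n)))))).imp
        (allLast φ)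

/-- The axioms of first-order Peano arithmetic. -/
inductive PeanoAxiom : arith.Sentence → Prop
  | succ_ne_zero : PeanoAxiom (closure (n := 1)
      ((tSucc (Term.var 0)).equal tZero).not)
  | succ_inj : PeanoAxiom (closure (n := 2)
      (((tSucc (Term.var 0)).equal (tSucc (Term.var 1))).imp
        ((Term.var 0 : arith.Term (Fin 2)).equal (Term.var 1))))
  | add_zero : PeanoAxiom (closure (n := 1)
      ((tAdd (Term.var 0) tZero).equal (Term.var 0)))
  | add_succ : PeanoAxiom (closure (n := 2)
      ((tAdd (Term.var 0) (tSucc (Term.var 1))).equal (tSucc (tAdd (Term.var 0) (Term.var 1)))))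
  | mul_zero : PeanoAxiom (closure (n := 1)
      ((tMul (Term.var 0) tZero).equal tZero))
  | mul_succ : PeanoAxiom (closure (n := 2)
      ((tMul (Term.var 0) (tSucc (Term.var 1))).equal
        (tAdd (tMul (Term.var 0) (Term.var 1)) (Term.var 0))))
  | induction {n : ℕ} (φ : arith.Formula (Fin (n + 1))) : PeanoAxiom (inductionAxiom φ)

/-- First-order Peano arithmetic. -/
def peano : arith.Theory := {φ | PeanoAxiom φ}

/-- Code of a function symbol applied to arguments with given codes. -/
def codeFunc : {k : ℕ} → ArithFunc k → (Fin k → ℕ) → ℕ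
  | _, .zero, _ => Nat.pair 1 0
  | _, .succ, c => Nat.pair 2 (c 0)
  | _, .add, c => Nat.pair 3 (Nat.pair (c 0) (c 1))
  | _, .mul, c => Nat.pair 4 (Nat.pair (c 0) (c 1))

/-- Gödel numbers of terms (in the variables of a sentence's subformula). -/
def codeTerm {n : ℕ} : arith.Term (Empty ⊕ Fin n) → ℕ
  | .var (Sum.inl e) => e.elim
  | .var (Sum.inr i) => Nat.pair 0 i
  | .func f ts => codeFunc f (fun i => codeTerm (ts i))

/-- Gödel numbers of formulas without free variables other than the de Bruijn levels below `n`. -/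
def codeFormula : {n : ℕ} → arith.BoundedFormula Empty n → ℕ
  | _, .falsum => Nat.pair 0 0
  | _, .equal t s => Nat.pair 1 (Nat.pair (codeTerm t) (codeTerm s))
  | _, .rel R _ => Empty.elim R
  | _, .imp φ ψ => Nat.pair 2 (Nat.pair (codeFormula φ) (codeFormula ψ))
  | _, .all φ => Nat.pair 3 (codeFormula φ)

/-- The Gödel number of a sentence of arithmetic. -/
def godelNumber (φ : arith.Sentence) : ℕ := codeFormula φ

/-- The class of (characteristic functions of the sets of Gödel numbers of) consistent completions
of Peano arithmetic. `T.IsMaximal` says that `T` is satisfiable, that is, consistent, and contains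
every sentence or its negation. -/
def consistentCompletionsPA : Set (ℕ → Bool) :=
  {X | ∃ T : arith.Theory, peano ⊆ T ∧ T.IsMaximal ∧
    ∀ k, X k = true ↔ ∃ φ ∈ T, godelNumber φ = k}

end DeepClass

/-!
Both classes `C` uniformly compute total extensions of every partial computable function `U`: the
value `U n` can be read off from any member of `C` at a position `G n`, computable from `n`. Such a
class is deep for every lower semicomputable continuous semi-measure `M`. By the recursion theorem,
`U` may refer to the positions at which its own values are read. For each `k` it looks at these
positions one after the other, inside the set of strings of a sufficiently large length `L` that
agree with all the values it has chosen so far, and waits until it sees that the strings having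
some value `b` at the next position weigh more than `2 ^ (-(k + 1))`; then it chooses the opposite
value and so discards them. Since `M` assigns total weight at most `1` to the strings of length
`L`, this happens fewer than `2 ^ (k + 1) + 1` times. At the step that waits forever, the strings
with either value weigh at most `2 ^ (-(k + 1))`, and all members of `C` pass through the remaining
strings, so that the level `L` of the tree of `C` weighs at most `2 ^ (-k)`.

For total extensions of `u` the position `G n` comes from the universality of `u`. For complete
theories it is the Gödel number of `φ(n)`, where `φ` is a Rosser formula: it says that a
witness of `U n = 1` occurs before any witness of `U n = 0`, and it decides `U n` in every model of
Robinson arithmetic.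
-/

namespace DeepClass

/-! ### Computable functions and recursively enumerable predicates -/

section Computability

variable {α β : Type*} [Primcodable α] [Primcodable β]

theorem computable_sum_range {n : α → ℕ} {f : α → ℕ → ℕ} (hn : Computable n)
    (hf : Computable₂ f) : Computable fun a => ∑ j ∈ Finset.range (n a), f a j := by
  have hadd : Computable₂ ((· + ·) : ℕ → ℕ → ℕ) := Primrec.nat_add.to_comp
  have hstep : Computable₂ fun (a : α) (p : ℕ × ℕ) => p.2 + f a p.1 :=
    hadd.comp (Computable.snd.comp Computable.snd)
      (hf.comp Computable.fst (Computable.fst.comp Computable.snd))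
  refine (Computable.nat_rec hn (Computable.const 0) hstep).of_eq fun a => ?_
  induction n a with
  | zero => rfl
  | succ m ih => rw [Finset.sum_range_succ, ← ih]

theorem computable_findGreatest {n : α → ℕ} {p : α → ℕ → Prop} [DecidableRel p]
    (hn : Computable n) (hp : Computable₂ fun a k => decide (p a k)) :
    Computable fun a => Nat.findGreatest (p a) (n a) := by
  have hstep : Computable₂ fun (a : α) (q : ℕ × ℕ) => if p a (q.1 + 1) then q.1 + 1 else q.2 :=
    have hsucc : Computable fun x : α × ℕ × ℕ => x.2.1 + 1 :=
      Computable.succ.comp (Computable.fst.comp Computable.snd)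
    (Computable.cond (hp.comp Computable.fst hsucc) hsucc
      (Computable.snd.comp Computable.snd)).of_eq fun x => Bool.cond_decide _ _ _
  refine (Computable.nat_rec hn (Computable.const 0) hstep).of_eq fun a => ?_
  induction n a with
  | zero => rfl
  | succ m ih => rw [Nat.findGreatest_succ, ← ih]

theorem computable_two_pow {f : α → ℕ} (hf : Computable f) : Computable fun a => 2 ^ f a := by
  have h : Computable₂ fun a b : ℕ => a ^ b := (Primrec₂.unpaired'.1 Nat.Primrec.pow).to_comp
  exact h.comp (Computable.const 2) hf

theorem computable_decide_eq [DecidableEq β] {f g : α → β} (hf : Computable f)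
    (hg : Computable g) : Computable fun a => decide (f a = g a) := by
  have h : Computable₂ fun a b : β => decide (a = b) := (Primrec.eq (α := β)).decide.to_comp
  exact h.comp hf hg

theorem computable_decide_lt {f g : α → ℕ} (hf : Computable f) (hg : Computable g) :
    Computable fun a => decide (f a < g a) := by
  have h : Computable₂ fun a b : ℕ => decide (a < b) := Primrec.nat_lt.decide.to_comp
  exact h.comp hf hg

theorem computable_natPair {f g : α → ℕ} (hf : Computable f) (hg : Computable g) :
    Computable fun a => Nat.pair (f a) (g a) := by
  have h : Computable₂ Nat.pair := Primrec₂.natPair.to_comp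
  exact h.comp hf hg

theorem rePred_eq {f g : α → β} (hf : Computable f) (hg : Computable g) :
    REPred fun a => f a = g a := by
  classical exact (Computable.computablePred (computable_decide_eq hf hg)).to_re

theorem rePred_comp {p : β → Prop} (hp : REPred p) {f : α → β} (hf : Computable f) :
    REPred fun a => p (f a) :=
  Partrec.comp hp hf

theorem rePred_and {p q : α → Prop} (hp : REPred p) (hq : REPred q) :
    REPred fun a => p a ∧ q a :=
  (Partrec.bind hp (hq.comp Computable.fst).to₂).dom_re.of_eq fun a => by
    simp [Part.bind_dom, Part.assert]

theorem rePred_exists_mem {f : α →. β} (hf : Partrec f) {p : α → β → Prop}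
    (hp : REPred fun x : α × β => p x.1 x.2) : REPred fun a => ∃ b ∈ f a, p a b :=
  (Partrec.bind hf hp.to₂).dom_re.of_eq fun a => by
    simp [Part.bind_dom, Part.assert, Part.mem_eq]

theorem rePred_forall_lt {p : α → ℕ → Prop} (hp : REPred fun x : α × ℕ => p x.1 x.2)
    {n : α → ℕ} (hn : Computable n) : REPred fun a => ∀ j < n a, p a j := by
  have hstep : Partrec₂ fun (a : α) (x : ℕ × Unit) =>
      Part.assert (p a x.1) fun _ => Part.some () :=
    rePred_comp hp (Computable.fst.pair (Computable.fst.comp Computable.snd))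
  refine (Partrec.nat_rec hn (Computable.const ()).partrec hstep).dom_re.of_eq fun a => ?_
  induction n a with
  | zero => simp
  | succ m ih =>
    rw [Nat.forall_lt_succ_right, ← ih]
    simp [Part.bind_dom, Part.assert]

theorem rePred_exists_nat {q : α → ℕ → Bool} (hq : Computable₂ q) :
    REPred fun a => ∃ s, q a s = true :=
  (Partrec.rfind hq.partrec₂).dom_re.of_eq fun a => by simp [Nat.rfind_dom]

open Nat.Partrec (Code)

theorem exists_computable_stages {p : α → Prop} (hp : REPred p) :
    ∃ q : α → ℕ → Bool, Computable₂ q ∧ (∀ a, Monotone (q a)) ∧ ∀ a, p a ↔ ∃ s, q a s = true := by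
  obtain ⟨c, hc⟩ := Code.exists_code.1 hp
  refine ⟨fun a s => (Code.evaln s c (Encodable.encode a)).isSome, ?_, fun a s t hst => ?_,
    fun a => ?_⟩
  · have hevaln : Computable fun x : α × ℕ => Code.evaln x.2 c (Encodable.encode x.1) :=
      Code.primrec_evaln.to_comp.comp ((Computable.snd.pair (Computable.const c)).pair
        (Computable.encode.comp Computable.fst))
    exact Primrec.option_isSome.to_comp.comp hevaln
  · refine Bool.le_iff_imp.2 fun h => ?_
    obtain ⟨x, hx⟩ := Option.isSome_iff_exists.1 h
    exact Option.isSome_iff_exists.2 ⟨x, Code.evaln_mono hst hx⟩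
  · have hdom : p a ↔ (Code.eval c (Encodable.encode a)).Dom := by
      rw [congrFun hc]
      simp [Part.assert]
    simp only [hdom, Part.dom_iff_mem, Code.evaln_complete, Option.isSome_iff_exists]
    exact exists_comm

theorem exists_partrec_selector {p : α → Bool → Prop} (hp : ∀ b, REPred fun a => p a b) :
    ∃ ψ : α →. Bool, Partrec ψ ∧ ∀ a, (∀ b ∈ ψ a, p a b) ∧ ((∃ b, p a b) → (ψ a).Dom) := by
  have hconst (b : Bool) : Partrec fun a => (Part.assert (p a b) fun _ => Part.some ()).map
      fun _ => b :=
    (hp b).map (Computable.const b).to₂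
  obtain ⟨ψ, hψ, hspec⟩ := (hconst true).merge' (hconst false)
  refine ⟨ψ, hψ, fun a => ⟨fun b hb => ?_, ?_⟩⟩
  · have hmem (c : Bool) (h : b ∈ (Part.assert (p a c) fun _ => Part.some ()).map fun _ => c) :
        p a b := by
      obtain ⟨_, ⟨⟨hc, _⟩, _⟩, rfl⟩ := (Part.mem_map_iff _).1 h
      exact hc
    exact ((hspec a).1 b hb).elim (hmem true) (hmem false)
  · rintro ⟨_ | _, h⟩
    · exact (hspec a).2.2 (Or.inr ⟨h, trivial⟩)
    · exact (hspec a).2.2 (Or.inl ⟨h, trivial⟩)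

theorem exists_partrec_with_fixedPoints : ∃ U : ℕ →. Bool, Partrec U ∧
    ∀ F : ℕ → ℕ →. Bool, Partrec₂ F → ∃ e, ∀ x, U (Nat.pair e x) = F e x := by
  have heval : Partrec fun n : ℕ => Code.eval (Denumerable.ofNat Code n.unpair.1) n.unpair.2 :=
    Code.eval_part.comp ((Computable.ofNat Code).comp (Computable.fst.comp Computable.unpair))
      (Computable.snd.comp Computable.unpair)
  refine ⟨_, heval.map (computable_decide_eq Computable.snd (Computable.const 1)).to₂,
    fun F hF => ?_⟩
  have hF' : Partrec₂ fun (c : Code) (x : ℕ) => (F (Encodable.encode c) x).map Bool.toNat :=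
    (hF.comp (Computable.encode.comp Computable.fst) Computable.snd).map
      ((Primrec.dom_finite Bool.toNat).to_comp.comp Computable.snd).to₂
  obtain ⟨c, hc⟩ := Code.fixed_point₂ hF'
  refine ⟨Encodable.encode c, fun x => ?_⟩
  have hid : ((fun n : ℕ => decide (n = 1)) ∘ Bool.toNat) = id := funext fun b => by cases b <;> rfl
  simp only [Nat.unpair_pair, Denumerable.ofNat_encode, hc, Part.map_map, hid]
  exact Part.map_id' (fun _ => rfl) _

end Computability

/-! ### Weights of levels of trees -/

section Weight

variable {ρ : List Bool → ℝ}

theorem weight_eq_sum (ρ : List Bool → ℝ) {S : Set (List Bool)} (hS : S.Finite) :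
    weight ρ S = ∑ σ ∈ hS.toFinset, ρ σ :=
  finsum_mem_eq_finite_toFinset_sum _ hS

theorem weight_union (ρ : List Bool → ℝ) {S S' : Set (List Bool)} (h : Disjoint S S')
    (hS : S.Finite) (hS' : S'.Finite) : weight ρ (S ∪ S') = weight ρ S + weight ρ S' :=
  finsum_mem_union h hS hS'

theorem IsContinuousSemimeasure.nonneg (hρ : IsContinuousSemimeasure ρ) (σ : List Bool) :
    0 ≤ ρ σ :=
  (hρ.mem_Icc σ).1

theorem IsContinuousSemimeasure.weight_nonneg (hρ : IsContinuousSemimeasure ρ)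
    (S : Set (List Bool)) : 0 ≤ weight ρ S :=
  finsum_nonneg fun σ => finsum_nonneg fun _ => hρ.nonneg σ

theorem IsContinuousSemimeasure.weight_mono (hρ : IsContinuousSemimeasure ρ)
    {S S' : Set (List Bool)} (h : S ⊆ S') (hS' : S'.Finite) : weight ρ S ≤ weight ρ S' := by
  rw [weight_eq_sum ρ (hS'.subset h), weight_eq_sum ρ hS']
  exact Finset.sum_le_sum_of_subset_of_nonneg (Set.Finite.toFinset_mono h)
    fun σ _ _ => hρ.nonneg σ

theorem IsContinuousSemimeasure.weight_level_mono (hρ : IsContinuousSemimeasure ρ)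
    {S S' : Set (List Bool)} {n : ℕ} (h : ∀ σ ∈ S, σ.length = n → σ ∈ S') :
    weight ρ (level S n) ≤ weight ρ (level S' n) :=
  hρ.weight_mono (fun σ hσ => ⟨h σ hσ.1 hσ.2, hσ.2⟩) (level_finite S' n)

theorem IsContinuousSemimeasure.weight_level_succ_le (hρ : IsContinuousSemimeasure ρ)
    {T : Set (List Bool)} (hT : ∀ σ b, σ ++ [b] ∈ T → σ ∈ T) (n : ℕ) :
    weight ρ (level T (n + 1)) ≤ weight ρ (level T n) := by
  rw [weight_eq_sum ρ (level_finite T (n + 1)), weight_eq_sum ρ (level_finite T n)]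
  set F := (level_finite T n).toFinset
  have hsub : (level_finite T (n + 1)).toFinset ⊆
      (F ×ˢ Finset.univ).image fun p : List Bool × Bool => p.1 ++ [p.2] := by
    intro τ hτ
    obtain ⟨hτ, hlen⟩ := (Set.Finite.mem_toFinset _).1 hτ
    rcases List.eq_nil_or_concat' τ with rfl | ⟨σ, b, rfl⟩
    · cases hlen
    · refine Finset.mem_image.2 ⟨(σ, b), ?_, rfl⟩
      simpa [F, level] using And.intro (hT σ b hτ) (by simpa using hlen)
  calc ∑ τ ∈ (level_finite T (n + 1)).toFinset, ρ τ
      ≤ ∑ τ ∈ (F ×ˢ Finset.univ).image fun p : List Bool × Bool => p.1 ++ [p.2], ρ τ :=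
        Finset.sum_le_sum_of_subset_of_nonneg hsub fun τ _ _ => hρ.nonneg τ
    _ = ∑ σ ∈ F, ∑ b : Bool, ρ (σ ++ [b]) := by
        rw [Finset.sum_image fun p _ q _ h => Prod.ext_iff.2 (by simpa using h),
          Finset.sum_product]
    _ ≤ ∑ σ ∈ F, ρ σ := Finset.sum_le_sum fun σ _ => by
        simpa [add_comm] using hρ.split σ

theorem IsContinuousSemimeasure.weight_level_antitone (hρ : IsContinuousSemimeasure ρ)
    {T : Set (List Bool)} (hT : ∀ σ b, σ ++ [b] ∈ T → σ ∈ T) :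
    Antitone fun n => weight ρ (level T n) :=
  antitone_nat_of_succ_le (hρ.weight_level_succ_le hT)

theorem IsContinuousSemimeasure.weight_level_le_one (hρ : IsContinuousSemimeasure ρ)
    (T : Set (List Bool)) (n : ℕ) : weight ρ (level T n) ≤ 1 := by
  have hroot : level Set.univ 0 = {([] : List Bool)} := by ext σ; simp [level]
  calc weight ρ (level T n) ≤ weight ρ (level Set.univ n) :=
        hρ.weight_level_mono fun _ _ _ => trivial
    _ ≤ weight ρ (level Set.univ 0) :=
        hρ.weight_level_antitone (fun _ _ _ => trivial) n.zero_le
    _ = 1 := by simp [hroot, weight, hρ.root]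

end Weight

theorem mem_canonicalTree_of_append_mem {C : Set (ℕ → Bool)} {σ τ : List Bool}
    (h : σ ++ τ ∈ canonicalTree C) : σ ∈ canonicalTree C := by
  obtain ⟨X, hX, hp⟩ := h
  refine ⟨X, hX, fun i hi => ?_⟩
  rw [← hp i (List.length_append ▸ Nat.lt_add_right _ hi), List.getElem_append_left hi]

theorem isDeep_of_weight_level_le {M : List Bool → ℝ} (hM : IsContinuousSemimeasure M)
    {C : Set (ℕ → Bool)} {l : ℕ → ℕ} (hl : Computable l)
    (h : ∀ k, weight M (level (canonicalTree C) (l k)) ≤ (1 / 2 : ℝ) ^ k) : IsDeep M C := by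
  refine ⟨fun n => Nat.findGreatest (fun k => l k ≤ n) n, ⟨?_, fun m n hmn => ?_, fun k => ?_⟩,
    fun n => ?_⟩
  · have hle : Computable₂ fun a b : ℕ => decide (a ≤ b) := Primrec.nat_le.decide.to_comp
    exact computable_findGreatest Computable.id
      (hle.comp (hl.comp Computable.snd) Computable.fst).to₂
  · exact Nat.findGreatest_mono (fun k hk => le_trans hk hmn) hmn
  · exact ⟨max k (l k), Nat.le_findGreatest (le_max_left _ _) (le_max_right _ _)⟩
  · rcases eq_or_ne (Nat.findGreatest (fun k => l k ≤ n) n) 0 with h0 | h0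
    · simpa only [h0, pow_zero] using hM.weight_level_le_one _ n
    · exact (hM.weight_level_antitone (fun _ _ => mem_canonicalTree_of_append_mem)
        (Nat.findGreatest_of_ne_zero (P := fun k => l k ≤ n) rfl h0)).trans (h _)

/-! ### Approximation from below -/

/-- The bits of `m` below position `n`, least significant first. As `m` runs through the numbers
below `2 ^ n`, this enumerates the strings of length `n`. -/
def bitString (n m : ℕ) : List Bool :=
  (List.range n).map m.testBit

theorem computable_bitString : Computable₂ bitString := by
  have hpow : Primrec₂ fun a b : ℕ => a ^ b := Primrec₂.unpaired'.1 Nat.Primrec.pow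
  have hbit : Primrec₂ fun m i : ℕ => m.testBit i := by
    simp only [Nat.testBit_eq_decide_div_mod_eq]
    exact (Primrec.eq.comp (Primrec.nat_mod.comp (Primrec.nat_div.comp Primrec.fst
      (hpow.comp (Primrec.const 2) Primrec.snd)) (Primrec.const 2)) (Primrec.const 1)).decide
  exact (Primrec.list_map (Primrec.list_range.comp Primrec.fst)
    (hbit.comp (Primrec.snd.comp Primrec.fst) Primrec.snd).to₂).to_comp

theorem bitString_injOn (n : ℕ) : Set.InjOn (bitString n) (Finset.range (2 ^ n)) := by
  intro m hm m' hm' h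
  refine Nat.eq_of_testBit_eq fun i => ?_
  rcases lt_or_ge i n with hi | hi
  · simpa [bitString, hi] using congrArg (fun σ => σ[i]?) h
  · have hle : 2 ^ n ≤ 2 ^ i := Nat.pow_le_pow_right two_pos hi
    rw [Nat.testBit_lt_two_pow ((Finset.mem_range.1 hm).trans_le hle),
      Nat.testBit_lt_two_pow ((Finset.mem_range.1 hm').trans_le hle)]

theorem exists_bitString_eq (σ : List Bool) : ∃ m < 2 ^ σ.length, bitString σ.length m = σ := by
  refine ⟨Nat.ofBits fun i : Fin σ.length => σ[i], Nat.ofBits_lt_two_pow _, ?_⟩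
  refine List.ext_getElem (by simp [bitString]) fun i _ hi => ?_
  simp [bitString, Nat.testBit_ofBits_lt _ i hi]

open Classical in
theorem weight_level_eq_sum_bitString (ρ : List Bool → ℝ) (S : Set (List Bool)) (n : ℕ) :
    weight ρ (level S n) =
      ∑ m ∈ Finset.range (2 ^ n), if bitString n m ∈ S then ρ (bitString n m) else 0 := by
  have himage : (level_finite S n).toFinset =
      {m ∈ Finset.range (2 ^ n) | bitString n m ∈ S}.image (bitString n) := by
    ext σ
    simp only [Set.Finite.mem_toFinset, Finset.mem_image, Finset.mem_filter, Finset.mem_range]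
    constructor
    · rintro ⟨hσ, rfl⟩
      obtain ⟨m, hm, h⟩ := exists_bitString_eq σ
      exact ⟨m, ⟨hm, h.symm ▸ hσ⟩, h⟩
    · rintro ⟨m, ⟨-, hS⟩, rfl⟩
      exact ⟨hS, by simp [bitString]⟩
  rw [weight_eq_sum ρ (level_finite S n), himage, Finset.sum_image, Finset.sum_filter]
  exact (bitString_injOn n).mono (Finset.coe_subset.2 (Finset.filter_subset _ _))

open Filter Topology

/-- A real-valued function is lower approximable if it is the pointwise limit of a computable
sequence of dyadic rationals that stay below it. The `s`-th approximation has denominator `2 ^ s`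
and the sequence need not be monotone, so that sums can be approximated termwise. -/
def LowerApproximable {α : Type*} [Primcodable α] (f : α → ℝ) : Prop :=
  ∃ N : α → ℕ → ℕ, Computable₂ N ∧ (∀ a s, (N a s : ℝ) / 2 ^ s ≤ f a) ∧
    ∀ a, Tendsto (fun s => (N a s : ℝ) / 2 ^ s) atTop (𝓝 (f a))

theorem IsLowerSemicomputable.lowerApproximable {ρ : List Bool → ℝ}
    (h : IsLowerSemicomputable ρ) : LowerApproximable ρ := by
  obtain ⟨q, hq, hlim⟩ := h
  let r (σ : List Bool) (s : ℕ) : ℝ := (q σ s).1 / 2 ^ (q σ s).2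
  have hr (σ : List Bool) (s : ℕ) : 0 ≤ r σ s := by positivity
  have hle (σ : List Bool) (s : ℕ) : r σ s ≤ ρ σ := (hlim σ).1.ge_of_tendsto (hlim σ).2 s
  have hfloor (σ : List Bool) (s : ℕ) :
      (q σ s).1 * 2 ^ s / 2 ^ (q σ s).2 = ⌊r σ s * 2 ^ s⌋₊ := by
    rw [← Nat.floor_div_eq_div (K := ℝ)]
    push_cast
    rw [div_mul_eq_mul_div]
  have hupper (σ : List Bool) (s : ℕ) : (⌊r σ s * 2 ^ s⌋₊ : ℝ) / 2 ^ s ≤ r σ s := by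
    rw [div_le_iff₀ (by positivity)]
    exact Nat.floor_le (mul_nonneg (hr σ s) (by positivity))
  have hlower (σ : List Bool) (s : ℕ) : r σ s - (1 / 2) ^ s ≤ (⌊r σ s * 2 ^ s⌋₊ : ℝ) / 2 ^ s := by
    rw [le_div_iff₀ (by positivity), sub_mul, ← mul_pow, one_div_mul_cancel two_ne_zero, one_pow]
    exact (Nat.sub_one_lt_floor _).le
  refine ⟨fun σ s => ⌊r σ s * 2 ^ s⌋₊, ?_, fun σ s => (hupper σ s).trans (hle σ s), fun σ => ?_⟩
  · have hmul : Computable₂ fun a b : ℕ => a * b := Primrec.nat_mul.to_comp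
    have hdiv : Computable₂ fun a b : ℕ => a / b := Primrec.nat_div.to_comp
    have hq' : Computable fun p : List Bool × ℕ => q p.1 p.2 := hq
    exact (hdiv.comp (hmul.comp (Computable.fst.comp hq') (computable_two_pow Computable.snd))
      (computable_two_pow (Computable.snd.comp hq'))).of_eq fun p => hfloor p.1 p.2
  · refine tendsto_of_tendsto_of_tendsto_of_le_of_le ?_ (hlim σ).2 (hlower σ) (hupper σ)
    simpa using (hlim σ).2.sub
      (tendsto_pow_atTop_nhds_zero_of_lt_one (r := (1 / 2 : ℝ)) (by norm_num) (by norm_num))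

namespace LowerApproximable

variable {α β : Type*} [Primcodable α] [Primcodable β]

theorem comp {f : β → ℝ} (hf : LowerApproximable f) {g : α → β} (hg : Computable g) :
    LowerApproximable fun a => f (g a) := by
  obtain ⟨N, hN, hle, hlim⟩ := hf
  exact ⟨fun a => N (g a), hN.comp (hg.comp Computable.fst) Computable.snd,
    fun a => hle (g a), fun a => hlim (g a)⟩

theorem sum_range {f : α → ℕ → ℝ} (hf : LowerApproximable fun x : α × ℕ => f x.1 x.2)
    {n : α → ℕ} (hn : Computable n) :
    LowerApproximable fun a => ∑ j ∈ Finset.range (n a), f a j := by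
  obtain ⟨N, hN, hle, hlim⟩ := hf
  refine ⟨fun a s => ∑ j ∈ Finset.range (n a), N (a, j) s,
    computable_sum_range (hn.comp Computable.fst) ?_, fun a s => ?_, fun a => ?_⟩
  · exact hN.comp ((Computable.fst.comp Computable.fst).pair Computable.snd)
      (Computable.snd.comp Computable.fst)
  · rw [Nat.cast_sum, Finset.sum_div]
    exact Finset.sum_le_sum fun j _ => hle (a, j) s
  · simp only [Nat.cast_sum, Finset.sum_div]
    exact tendsto_finsetSum _ fun j _ => hlim (a, j)

open Classical in
theorem ite_rePred {f : α → ℝ} (hf : LowerApproximable f) (hf₀ : ∀ a, 0 ≤ f a) {p : α → Prop}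
    (hp : REPred p) : LowerApproximable fun a => if p a then f a else 0 := by
  obtain ⟨N, hN, hle, hlim⟩ := hf
  obtain ⟨q, hq, hmono, hstage⟩ := exists_computable_stages hp
  refine ⟨fun a s => bif q a s then N a s else 0, Computable.cond hq hN (Computable.const 0),
    fun a s => ?_, fun a => ?_⟩
  · cases hqs : q a s
    · have : 0 ≤ if p a then f a else 0 := ite_nonneg (hf₀ a) le_rfl
      simpa [hqs] using this
    · simpa [hqs, (hstage a).2 ⟨s, hqs⟩] using hle a s
  · by_cases hpa : p a
    · obtain ⟨s₀, hs₀⟩ := (hstage a).1 hpa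
      simp only [if_pos hpa]
      refine (hlim a).congr' ?_
      filter_upwards [eventually_ge_atTop s₀] with s hs
      rw [Bool.le_iff_imp.1 (hmono a hs) hs₀, cond_true]
    · have hq' (s : ℕ) : q a s = false := Bool.eq_false_iff.2 fun h => hpa ((hstage a).2 ⟨s, h⟩)
      simp [hpa, hq']

theorem rePred_half_pow_lt {f : α → ℝ} (hf : LowerApproximable f) {k : α → ℕ}
    (hk : Computable k) : REPred fun a => (1 / 2 : ℝ) ^ k a < f a := by
  obtain ⟨N, hN, hle, hlim⟩ := hf
  have hmul : Computable₂ fun a b : ℕ => a * b := Primrec.nat_mul.to_comp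
  have htest : Computable₂ fun a s => decide (2 ^ s < N a s * 2 ^ k a) :=
    (computable_decide_lt (computable_two_pow Computable.snd)
      (hmul.comp hN (computable_two_pow (hk.comp Computable.fst)))).to₂
  refine (rePred_exists_nat htest).of_eq fun a => ?_
  have hiff (s : ℕ) : 2 ^ s < N a s * 2 ^ k a ↔ (1 / 2 : ℝ) ^ k a < N a s / 2 ^ s := by
    rw [lt_div_iff₀ (by positivity), one_div, inv_pow, inv_mul_lt_iff₀ (by positivity), mul_comm]
    exact_mod_cast Iff.rfl
  simp only [decide_eq_true_iff, hiff]
  exact ⟨fun ⟨s, hs⟩ => hs.trans_le (hle a s),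
    fun h => ((hlim a).eventually (lt_mem_nhds h)).exists⟩

theorem weight_level {ρ : List Bool → ℝ} (hρ : LowerApproximable ρ) (hρ₀ : ∀ σ, 0 ≤ ρ σ)
    {S : α → Set (List Bool)} (hS : REPred fun x : α × List Bool => x.2 ∈ S x.1)
    {n : α → ℕ} (hn : Computable n) : LowerApproximable fun a => weight ρ (level (S a) (n a)) := by
  simp only [weight_level_eq_sum_bitString]
  have hbits : Computable fun x : α × ℕ => bitString (n x.1) x.2 :=
    computable_bitString.comp (hn.comp Computable.fst) Computable.snd
  exact sum_range (f := fun a m => open Classical in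
      if bitString (n a) m ∈ S a then ρ (bitString (n a) m) else 0)
    ((hρ.comp hbits).ite_rePred (fun _ => hρ₀ _) (rePred_comp hS (Computable.fst.pair hbits)))
    (computable_two_pow hn)

end LowerApproximable

/-! ### Diagonalization against a semi-measure -/

/-- The strings that have the value `v j` at position `p j` for every `j < i`; there are none
unless all these values are defined. -/
def agreeing (p : ℕ → ℕ) (v : ℕ →. Bool) (i : ℕ) : Set (List Bool) :=
  {σ | ∀ j < i, ∃ b ∈ v j, σ[p j]? = some b}

/-- The strings in `agreeing p v i` with value `b` at the next position `p i`. -/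
def branch (p : ℕ → ℕ) (v : ℕ →. Bool) (i : ℕ) (b : Bool) : Set (List Bool) :=
  {σ ∈ agreeing p v i | σ[p i]? = some b}

/-- The sequence of values `v` at positions `p` diagonalizes against `ρ` at length `L` with
threshold `ε`: the strings of length `L` violating a value but none of the previous ones weigh more
than `ε`, and a value is defined as soon as some bit would achieve this. -/
structure IsDiagonalizing (ρ : List Bool → ℝ) (L : ℕ) (p : ℕ → ℕ) (v : ℕ →. Bool) (ε : ℝ) :
    Prop where
  lt_weight_of_mem : ∀ i, ∀ b ∈ v i, ε < weight ρ (level (branch p v i (!b)) L)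
  dom_of_lt_weight : ∀ i b, ε < weight ρ (level (branch p v i (!b)) L) → (v i).Dom

theorem mem_agreeing_of_isPrefixOf {p : ℕ → ℕ} {v : ℕ →. Bool} {X : ℕ → Bool}
    (hX : ∀ j, ∀ b ∈ v j, X (p j) = b) {i : ℕ} (hv : ∀ j < i, (v j).Dom) {σ : List Bool}
    (hσ : IsPrefixOf σ X) (hp : ∀ j < i, p j < σ.length) : σ ∈ agreeing p v i := fun j hj =>
  ⟨_, Part.get_mem (hv j hj), by
    rw [List.getElem?_eq_getElem (hp j hj), hσ _ (hp j hj), hX j _ (Part.get_mem (hv j hj))]⟩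

namespace IsDiagonalizing

variable {ρ : List Bool → ℝ} {L : ℕ} {p : ℕ → ℕ} {v : ℕ →. Bool} {ε : ℝ}

theorem weight_agreeing_succ_add_le (hv : IsDiagonalizing ρ L p v ε)
    (hρ : IsContinuousSemimeasure ρ) {i : ℕ} (hi : (v i).Dom) :
    weight ρ (level (agreeing p v (i + 1)) L) + ε ≤ weight ρ (level (agreeing p v i) L) := by
  obtain ⟨b, hb⟩ := Part.dom_iff_mem.1 hi
  have hdisj : Disjoint (level (agreeing p v (i + 1)) L) (level (branch p v i (!b)) L) := by
    refine Set.disjoint_left.2 fun σ hσ hσ' => ?_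
    obtain ⟨c, hc, hσc⟩ := hσ.1 i i.lt_succ_self
    obtain rfl := Part.mem_unique hb hc
    simpa using hσc.symm.trans hσ'.1.2
  calc weight ρ (level (agreeing p v (i + 1)) L) + ε
      ≤ weight ρ (level (agreeing p v (i + 1)) L) + weight ρ (level (branch p v i (!b)) L) :=
        (add_le_add_iff_left _).2 (hv.lt_weight_of_mem i b hb).le
    _ = weight ρ (level (agreeing p v (i + 1)) L ∪ level (branch p v i (!b)) L) :=
        (weight_union ρ hdisj (level_finite _ _) (level_finite _ _)).symm
    _ ≤ weight ρ (level (agreeing p v i) L) := hρ.weight_mono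
        (Set.union_subset (fun σ hσ => ⟨fun j hj => hσ.1 j (hj.trans i.lt_succ_self), hσ.2⟩)
          fun σ hσ => ⟨hσ.1.1, hσ.2⟩) (level_finite _ _)

theorem weight_agreeing_le_of_not_dom (hv : IsDiagonalizing ρ L p v ε)
    (hρ : IsContinuousSemimeasure ρ) {i : ℕ} (hp : p i < L) (hi : ¬(v i).Dom) :
    weight ρ (level (agreeing p v i) L) ≤ 2 * ε := by
  have hle (b : Bool) : weight ρ (level (branch p v i b) L) ≤ ε :=
    not_lt.1 fun h => hi (hv.dom_of_lt_weight i (!b) (by rwa [Bool.not_not]))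
  have hdisj : Disjoint (level (branch p v i false) L) (level (branch p v i true) L) :=
    Set.disjoint_left.2 fun σ hσ hσ' => by simpa using hσ.1.2.symm.trans hσ'.1.2
  have hsub : level (agreeing p v i) L ⊆
      level (branch p v i false) L ∪ level (branch p v i true) L := by
    rintro σ ⟨hσ, rfl⟩
    have hbit := List.getElem?_eq_getElem hp
    cases hb : σ[p i] <;> rw [hb] at hbit
    · exact Or.inl ⟨⟨hσ, hbit⟩, rfl⟩
    · exact Or.inr ⟨⟨hσ, hbit⟩, rfl⟩
  calc weight ρ (level (agreeing p v i) L)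
      ≤ weight ρ (level (branch p v i false) L ∪ level (branch p v i true) L) :=
        hρ.weight_mono hsub ((level_finite _ _).union (level_finite _ _))
    _ = weight ρ (level (branch p v i false) L) + weight ρ (level (branch p v i true) L) :=
        weight_union ρ hdisj (level_finite _ _) (level_finite _ _)
    _ ≤ 2 * ε := by linarith [hle false, hle true]

theorem weight_agreeing_add_mul_le_one (hv : IsDiagonalizing ρ L p v ε)
    (hρ : IsContinuousSemimeasure ρ) {i : ℕ} (hi : ∀ j < i, (v j).Dom) :
    weight ρ (level (agreeing p v i) L) + i * ε ≤ 1 := by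
  induction i with
  | zero => simpa using hρ.weight_level_le_one _ L
  | succ i ih =>
    have hstep := hv.weight_agreeing_succ_add_le hρ (hi i i.lt_succ_self)
    have hprev := ih fun j hj => hi j (hj.trans i.lt_succ_self)
    push_cast
    linarith

theorem exists_not_dom (hv : IsDiagonalizing ρ L p v ε) (hρ : IsContinuousSemimeasure ρ) {m : ℕ}
    (hm : 1 < m * ε) : ∃ i < m, ¬(v i).Dom ∧ ∀ j < i, (v j).Dom := by
  have hex : ∃ i < m, ¬(v i).Dom := by
    by_contra! hdom
    linarith [hv.weight_agreeing_add_mul_le_one hρ hdom,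
      hρ.weight_nonneg (level (agreeing p v m) L)]
  classical
  obtain ⟨hlt, hdom⟩ := Nat.find_spec hex
  exact ⟨Nat.find hex, hlt, hdom, fun j hj =>
    not_not.1 fun h => Nat.find_min hex hj ⟨hj.trans hlt, h⟩⟩

theorem weight_canonicalTree_le (hv : IsDiagonalizing ρ L p v ε) (hρ : IsContinuousSemimeasure ρ)
    {m : ℕ} (hm : 1 < m * ε) (hp : ∀ j < m, p j < L) {C : Set (ℕ → Bool)}
    (hC : ∀ X ∈ C, ∀ j, ∀ b ∈ v j, X (p j) = b) :
    weight ρ (level (canonicalTree C) L) ≤ 2 * ε := by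
  obtain ⟨i, him, hi, hdom⟩ := hv.exists_not_dom hρ hm
  refine le_trans (hρ.weight_level_mono ?_) (hv.weight_agreeing_le_of_not_dom hρ (hp i him) hi)
  rintro σ ⟨X, hX, hσ⟩ rfl
  exact mem_agreeing_of_isPrefixOf (hC X hX) hdom hσ fun j hj => hp j (hj.trans him)

end IsDiagonalizing

theorem rePred_mem_branch {α : Type*} [Primcodable α] {p : α → ℕ → ℕ} (hp : Computable₂ p)
    {v : α → ℕ →. Bool} (hv : Partrec₂ v) {i : α → ℕ} (hi : Computable i) (b : Bool) :
    REPred fun x : α × List Bool => x.2 ∈ branch (p x.1) (v x.1) (i x.1) b := by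
  have hget : Computable₂ fun (σ : List Bool) (n : ℕ) => σ[n]? := Computable.list_getElem?
  refine rePred_and (rePred_forall_lt (rePred_exists_mem ?_ ?_) (hi.comp Computable.fst)) ?_
  · exact hv.comp (Computable.fst.comp Computable.fst) Computable.snd
  · exact rePred_eq (hget.comp (Computable.snd.comp (Computable.fst.comp Computable.fst))
      (hp.comp (Computable.fst.comp (Computable.fst.comp Computable.fst))
        (Computable.snd.comp Computable.fst))) (Computable.option_some.comp Computable.snd)
  · exact rePred_eq (hget.comp Computable.snd
      (hp.comp Computable.fst (hi.comp Computable.fst))) (Computable.const _)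

/-- Uniformly in its members, the class `C` computes total extensions of `ψ`: some computable `G`
locates the bit `n` of the extension in each member of `C`. -/
def UniformlyExtends (C : Set (ℕ → Bool)) (ψ : ℕ →. Bool) : Prop :=
  ∃ G : ℕ → ℕ, Computable G ∧ ∀ X ∈ C, X ∘ G ∈ totalExtensions ψ

theorem exists_partrec_isDiagonalizing {M : List Bool → ℝ} (hM : IsContinuousSemimeasure M)
    (hls : IsLowerSemicomputable M) {p : ℕ × ℕ → ℕ → ℕ} (hp : Computable₂ p)
    {v : ℕ × ℕ → ℕ →. Bool} (hv : Partrec₂ v) {L : ℕ × ℕ → ℕ} (hL : Computable L) :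
    ∃ F : ℕ → ℕ →. Bool, Partrec₂ F ∧ ∀ e k, (∀ j, v (e, k) j = F e (Nat.pair k j)) →
      IsDiagonalizing M (L (e, k)) (p (e, k)) (v (e, k)) ((1 / 2) ^ (k + 1)) := by
  have hlt (b : Bool) : REPred fun x : (ℕ × ℕ) × ℕ => (1 / 2 : ℝ) ^ (x.1.2 + 1) <
      weight M (level (branch (p x.1) (v x.1) x.2 (!b)) (L x.1)) :=
    (hls.lowerApproximable.weight_level hM.nonneg
      (rePred_mem_branch (hp.comp (Computable.fst.comp Computable.fst) Computable.snd).to₂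
        (hv.comp (Computable.fst.comp Computable.fst) Computable.snd).to₂ Computable.snd (!b))
      (hL.comp Computable.fst)).rePred_half_pow_lt
        (Computable.succ.comp (Computable.snd.comp Computable.fst))
  obtain ⟨ψ, hψ, hspec⟩ := exists_partrec_selector hlt
  have hunpair : Computable fun x : ℕ × ℕ => ((x.1, x.2.unpair.1), x.2.unpair.2) :=
    have h := Computable.unpair.comp Computable.snd
    (Computable.fst.pair (Computable.fst.comp h)).pair (Computable.snd.comp h)
  refine ⟨fun e x => ψ ((e, x.unpair.1), x.unpair.2), hψ.comp hunpair, fun e k hF => ?_⟩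
  simp only [Nat.unpair_pair] at hF
  exact ⟨fun i b hb => (hspec ((e, k), i)).1 b (hF i ▸ hb),
    fun i b hb => hF i ▸ (hspec ((e, k), i)).2 ⟨b, hb⟩⟩

theorem isDeep_of_forall_uniformlyExtends {M : List Bool → ℝ} (hM : IsContinuousSemimeasure M)
    (hls : IsLowerSemicomputable M) {C : Set (ℕ → Bool)}
    (hC : ∀ ψ : ℕ →. Bool, Partrec ψ → UniformlyExtends C ψ) : IsDeep M C := by
  obtain ⟨U, hU, hfix⟩ := exists_partrec_with_fixedPoints
  obtain ⟨G, hG, hext⟩ := hC U hU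
  have hinput : Computable₂ fun (x : ℕ × ℕ) (j : ℕ) => Nat.pair x.1 (Nat.pair x.2 j) :=
    (computable_natPair (Computable.fst.comp Computable.fst)
      (computable_natPair (Computable.snd.comp Computable.fst) Computable.snd)).to₂
  let p (x : ℕ × ℕ) (j : ℕ) : ℕ := G (Nat.pair x.1 (Nat.pair x.2 j))
  have hp : Computable₂ p := hG.comp hinput
  let L (x : ℕ × ℕ) : ℕ := ∑ j ∈ Finset.range (2 ^ (x.2 + 1) + 1), (p x j + 1)
  have hL : Computable L := computable_sum_range
    (Computable.succ.comp (computable_two_pow (Computable.succ.comp Computable.snd)))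
    (Computable.succ.comp hp).to₂
  have hpL (x : ℕ × ℕ) : ∀ j < 2 ^ (x.2 + 1) + 1, p x j < L x := fun j hj =>
    Finset.single_le_sum (f := fun j => p x j + 1) (fun _ _ => Nat.zero_le _)
      (Finset.mem_range.2 hj)
  obtain ⟨F, hF, hdiag⟩ := exists_partrec_isDiagonalizing hM hls hp
    (v := fun x j => U (Nat.pair x.1 (Nat.pair x.2 j))) (hU.comp hinput) hL
  obtain ⟨e, he⟩ := hfix F hF
  refine isDeep_of_weight_level_le hM (hL.comp ((Computable.const e).pair Computable.id))
    fun k => ?_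
  have hsteps : (1 : ℝ) < (2 ^ (k + 1) + 1 : ℕ) * (1 / 2) ^ (k + 1) := by
    push_cast
    rw [add_mul, ← mul_pow, mul_one_div_cancel two_ne_zero, one_pow, one_mul]
    exact lt_add_of_pos_right 1 (by positivity)
  refine ((hdiag e k fun j => he _).weight_canonicalTree_le hM hsteps (hpL (e, k))
    fun X hX j => hext X hX _).trans_eq ?_
  rw [pow_succ]
  ring

theorem uniformlyExtends_totalExtensions {φ : ℕ → ℕ →. Bool} (hφ : IsEffectiveEnumeration φ)
    {u : ℕ →. Bool} (hu : IsUniversalFor u φ) {ψ : ℕ →. Bool} (hψ : Partrec ψ) :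
    UniformlyExtends (totalExtensions u) ψ := by
  obtain ⟨g, hg, hgu⟩ := hu.simulates
  obtain ⟨e, rfl⟩ := hφ.exhaustive ψ hψ
  exact ⟨g e, hg.comp (Computable.const e) Computable.id,
    fun X hX n b hb => hX (g e n) b (by rwa [hgu])⟩

theorem isPi01Class_totalExtensions {u : ℕ →. Bool} (hu : Partrec u) :
    IsPi01Class (totalExtensions u) := by
  refine ⟨{σ | ∃ b ∈ u (σ.length - 1), σ[σ.length - 1]? = some (!b)}, ?_, ?_⟩
  · have hlast : Computable fun σ : List Bool => σ.length - 1 :=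
      Computable.pred.comp Computable.list_length
    have hget : Computable₂ fun (σ : List Bool) (n : ℕ) => σ[n]? := Computable.list_getElem?
    exact rePred_exists_mem (hu.comp hlast) (rePred_eq
      (hget.comp Computable.fst (hlast.comp Computable.fst))
      (Computable.option_some.comp (Primrec.not.to_comp.comp Computable.snd)))
  · refine Set.ext fun X => ⟨?_, fun h n b hb => ?_⟩
    · rintro hX ⟨σ, ⟨b, hb, hσb⟩, hσ⟩
      obtain ⟨hlt, hσb⟩ := List.getElem?_eq_some_iff.1 hσb
      have hXb := hσ _ hlt
      rw [hσb, hX _ b hb] at hXb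
      exact Bool.not_ne_self b hXb
    · by_contra hne
      refine h ⟨List.ofFn fun i : Fin (n + 1) => X i, ⟨b, ?_, ?_⟩, fun i hi => List.getElem_ofFn hi⟩
      · rwa [List.length_ofFn]
      · rw [List.length_ofFn, Nat.add_sub_cancel, List.getElem?_ofFn, dif_pos n.lt_succ_self]
        exact congrArg some (Bool.eq_not_iff.2 hne)

open FirstOrder FirstOrder.Language

/-! ### Models of arithmetic -/

section Models

variable {A : Type*} [arith.Structure A]

variable (A) in
/-- The interpretation of the symbol `0` in a structure. -/
def mZero : A := Structure.funMap (L := arith) (M := A) ArithFunc.zero ![]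

/-- The interpretation of the symbol `S` in a structure. -/
def mSucc (x : A) : A := Structure.funMap (L := arith) (M := A) ArithFunc.succ ![x]

/-- The interpretation of the symbol `+` in a structure. -/
def mAdd (x y : A) : A := Structure.funMap (L := arith) (M := A) ArithFunc.add ![x, y]

/-- The interpretation of the symbol `·` in a structure. -/
def mMul (x y : A) : A := Structure.funMap (L := arith) (M := A) ArithFunc.mul ![x, y]

/-- The strict order that the formula `∃ z, z + S x = y` defines in a structure. -/
def mLt (x y : A) : Prop := ∃ z, mAdd z (mSucc x) = y

section Realize

variable {α : Type} (v : α → A) (s t : arith.Term α)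

@[simp] theorem realize_tZero : (tZero : arith.Term α).realize v = mZero A :=
  congrArg (Structure.funMap (L := arith) (M := A) ArithFunc.zero) (Subsingleton.elim _ _)

@[simp] theorem realize_tSucc : (tSucc t).realize v = mSucc (t.realize v) :=
  congrArg _ (funext fun i => by fin_cases i; rfl)

@[simp] theorem realize_tAdd : (tAdd s t).realize v = mAdd (s.realize v) (t.realize v) :=
  congrArg _ (funext fun i => by fin_cases i <;> rfl)

@[simp] theorem realize_tMul : (tMul s t).realize v = mMul (s.realize v) (t.realize v) :=
  congrArg _ (funext fun i => by fin_cases i <;> rfl)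

theorem realize_closure {n : ℕ} {φ : arith.Formula (Fin n)} :
    A ⊨ closure φ ↔ ∀ xs : Fin n → A, φ.Realize xs := by
  rw [closure, Sentence.Realize, BoundedFormula.realize_alls]
  exact forall_congr' fun xs => Formula.realize_relabel_sumInr φ

theorem realize_substLast {n m : ℕ} {φ : arith.Formula (Fin (n + 1))} {w : Fin n → Fin m}
    {t : arith.Term (Fin m)} {xs : Fin m → A} :
    (substLast φ w t).Realize xs ↔
      φ.Realize (Fin.snoc (α := fun _ => A) (xs ∘ w) (t.realize xs)) := by
  rw [substLast, Formula.Realize, BoundedFormula.realize_subst, Formula.Realize, iff_eq_eq]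
  congr 1
  funext i
  refine Fin.lastCases ?_ (fun j => ?_) i <;> simp

theorem realize_allLast {n : ℕ} {φ : arith.Formula (Fin (n + 1))} {xs : Fin n → A} :
    (allLast φ).Realize xs ↔ ∀ x : A, φ.Realize (Fin.snoc (α := fun _ => A) xs x) := by
  rw [allLast, Formula.Realize, BoundedFormula.realize_all]
  refine forall_congr' fun x => ?_
  rw [BoundedFormula.realize_relabel, Formula.Realize, iff_eq_eq]
  congr 1
  · funext i
    refine Fin.lastCases ?_ (fun j => ?_) i <;> simp [Fin.snoc]
  · exact Subsingleton.elim _ _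

end Realize

variable (A) in
/-- The axioms of Robinson arithmetic, as a property of structures. -/
structure IsRobinson : Prop where
  succ_ne_zero : ∀ x : A, mSucc x ≠ mZero A
  succ_inj : ∀ x y : A, mSucc x = mSucc y → x = y
  add_zero : ∀ x : A, mAdd x (mZero A) = x
  add_succ : ∀ x y : A, mAdd x (mSucc y) = mSucc (mAdd x y)
  mul_zero : ∀ x : A, mMul x (mZero A) = mZero A
  mul_succ : ∀ x y : A, mMul x (mSucc y) = mAdd (mMul x y) x
  zero_or_succ : ∀ x : A, x = mZero A ∨ ∃ y, x = mSucc y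

theorem zero_or_succ_of_models_peano (h : A ⊨ peano) (x : A) :
    x = mZero A ∨ ∃ y, x = mSucc y := by
  let φ : arith.Formula (Fin (0 + 1)) := ((Term.var 0).equal tZero) ⊔
    Formula.iExs (Fin 1) ((Term.var (Sum.inl 0)).equal (tSucc (Term.var (Sum.inr 0))))
  have hφ (xs : Fin (0 + 1) → A) : φ.Realize xs ↔ xs 0 = mZero A ∨ ∃ y, xs 0 = mSucc y := by
    simp only [φ, Formula.realize_sup, Formula.realize_equal, Formula.realize_iExs,
      realize_tZero, realize_tSucc, Term.realize_var, Sum.elim_inl, Sum.elim_inr]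
    exact or_congr Iff.rfl ⟨fun ⟨i, hi⟩ => ⟨_, hi⟩, fun ⟨y, hy⟩ => ⟨fun _ => y, hy⟩⟩
  have hind := realize_closure.1 (h.realize_of_mem _ (.induction φ)) Fin.elim0
  simp only [Formula.realize_imp, realize_substLast, realize_allLast, hφ] at hind
  exact hind (Or.inl (by simp [Fin.snoc])) (fun y _ => Or.inr ⟨y, by simp [Fin.snoc]⟩) x

theorem isRobinson_of_models_peano (h : A ⊨ peano) : IsRobinson A := by
  have hax {n : ℕ} {φ : arith.Formula (Fin n)} (hφ : PeanoAxiom (closure φ)) (xs : Fin n → A) :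
      φ.Realize xs := realize_closure.1 (h.realize_of_mem _ hφ) xs
  exact {
    succ_ne_zero x := by simpa [Formula.realize_not] using hax .succ_ne_zero ![x]
    succ_inj x y := by simpa [Formula.realize_imp] using hax .succ_inj ![x, y]
    add_zero x := by simpa using hax .add_zero ![x]
    add_succ x y := by simpa using hax .add_succ ![x, y]
    mul_zero x := by simpa using hax .mul_zero ![x]
    mul_succ x y := by simpa using hax .mul_succ ![x, y]
    zero_or_succ := zero_or_succ_of_models_peano h }

variable (A) in
/-- The interpretation in a structure of the numeral `S ⋯ S 0`. -/
def num : ℕ → A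
  | 0 => mZero A
  | n + 1 => mSucc (num n)

namespace IsRobinson

variable (hA : IsRobinson A)
include hA

theorem add_num (m n : ℕ) : mAdd (num A m) (num A n) = num A (m + n) := by
  induction n with
  | zero => exact hA.add_zero _
  | succ n ih => rw [num, hA.add_succ, ih, ← Nat.add_assoc, num]

theorem mul_num (m n : ℕ) : mMul (num A m) (num A n) = num A (m * n) := by
  induction n with
  | zero => exact hA.mul_zero _
  | succ n ih => rw [num, hA.mul_succ, ih, hA.add_num, Nat.mul_succ]

theorem num_injective : Function.Injective (num A) := by
  intro m
  induction m with
  | zero =>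
    rintro (_ | n) h
    · rfl
    · exact absurd h.symm (hA.succ_ne_zero _)
  | succ m ih =>
    rintro (_ | n) h
    · exact absurd h (hA.succ_ne_zero _)
    · rw [ih (hA.succ_inj _ _ h)]

theorem succ_lt_succ {x y : A} (h : mLt x y) : mLt (mSucc x) (mSucc y) :=
  h.imp fun z hz => by rw [hA.add_succ, hz]

theorem num_lt_num {m n : ℕ} (h : m < n) : mLt (num A m) (num A n) := by
  refine ⟨num A (n - (m + 1)), ?_⟩
  rw [← num, hA.add_num, Nat.sub_add_cancel h]

theorem lt_num_iff {n : ℕ} {x : A} : mLt x (num A n) ↔ ∃ m < n, x = num A m := by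
  refine ⟨fun h => ?_, fun ⟨m, hm, hx⟩ => hx ▸ hA.num_lt_num hm⟩
  induction n generalizing x with
  | zero =>
    obtain ⟨z, hz⟩ := h
    rw [hA.add_succ] at hz
    exact absurd hz (hA.succ_ne_zero _)
  | succ n ih =>
    obtain ⟨z, hz⟩ := h
    rw [hA.add_succ] at hz
    rcases hA.zero_or_succ x with rfl | ⟨y, rfl⟩
    · exact ⟨0, n.succ_pos, rfl⟩
    · obtain ⟨m, hm, rfl⟩ := ih ⟨z, hA.succ_inj _ _ hz⟩
      exact ⟨m + 1, Nat.succ_lt_succ hm, rfl⟩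

theorem lt_num_succ_or_num_lt (n : ℕ) (x : A) : mLt x (num A (n + 1)) ∨ mLt (num A n) x := by
  induction n generalizing x with
  | zero =>
    rcases hA.zero_or_succ x with rfl | ⟨y, rfl⟩
    · exact Or.inl (hA.num_lt_num Nat.one_pos)
    · exact Or.inr ⟨y, by rw [hA.add_succ, num, hA.add_zero]⟩
  | succ n ih =>
    rcases hA.zero_or_succ x with rfl | ⟨y, rfl⟩
    · exact Or.inl (hA.num_lt_num (Nat.succ_pos _))
    · exact (ih y).imp hA.succ_lt_succ hA.succ_lt_succ

end IsRobinson

end Models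

/-! ### Binumerable relations -/

section Binumerable

variable {α β : Type}

/-- Existential quantification over the variable `none` of a formula. -/
noncomputable def exNone (φ : arith.Formula (Option α)) : arith.Formula α :=
  Formula.iExs (Fin 1) (φ.relabel fun o => o.elim (Sum.inr 0) Sum.inl)

/-- The formula `s < t`, that is, `∃ z, z + S s = t`. -/
noncomputable def ltFormula (s t : arith.Term α) : arith.Formula α :=
  exNone ((tAdd (Term.var none) (tSucc (s.relabel some))).equal (t.relabel some))

/-- Existential quantification over the variable `none` of a formula, bounded by a term. -/
noncomputable def exNoneLT (t : arith.Term α) (φ : arith.Formula (Option α)) : arith.Formula α :=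
  exNone (ltFormula (Term.var none) (t.relabel some) ⊓ φ)

section Realize

variable {A : Type*} [arith.Structure A] {v : α → A}

theorem realize_exNone {φ : arith.Formula (Option α)} :
    (exNone φ).Realize v ↔ ∃ x, φ.Realize (Option.elim · x v) := by
  have hval (y : Fin 1 → A) :
      (Sum.elim v y ∘ fun o : Option α => o.elim (Sum.inr 0) Sum.inl) = (Option.elim · (y 0) v) :=
    funext fun o => by cases o <;> rfl
  simp only [exNone, Formula.realize_iExs, Formula.realize_relabel, hval]
  exact ⟨fun ⟨y, hy⟩ => ⟨y 0, hy⟩, fun ⟨x, hx⟩ => ⟨fun _ => x, hx⟩⟩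

theorem realize_ltFormula {s t : arith.Term α} :
    (ltFormula s t).Realize v ↔ mLt (s.realize v) (t.realize v) := by
  simp only [ltFormula, realize_exNone, Formula.realize_equal, realize_tAdd, realize_tSucc,
    Term.realize_relabel, Term.realize_var]
  rfl

theorem realize_exNoneLT {t : arith.Term α} {φ : arith.Formula (Option α)} :
    (exNoneLT t φ).Realize v ↔ ∃ x, mLt x (t.realize v) ∧ φ.Realize (Option.elim · x v) := by
  simp only [exNoneLT, realize_exNone, Formula.realize_inf, realize_ltFormula,
    Term.realize_relabel, Term.realize_var]
  rfl

theorem num_comp_elim (n : ℕ) (v : α → ℕ) :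
    num A ∘ (Option.elim · n v) = (Option.elim · (num A n) (num A ∘ v)) :=
  funext fun o => by cases o <;> rfl

end Realize

/-- A function on tuples of naturals that a term computes in all models of Robinson arithmetic. -/
def IsTermFn (f : (α → ℕ) → ℕ) : Prop :=
  ∃ t : arith.Term α, ∀ (A : Type) [arith.Structure A], IsRobinson A →
    ∀ v : α → ℕ, t.realize (num A ∘ v) = num A (f v)

/-- A relation on tuples of naturals defined, at the numerals of every model of Robinson
arithmetic, by one and the same formula. -/
def Binumerable (R : (α → ℕ) → Prop) : Prop :=
  ∃ φ : arith.Formula α, ∀ (A : Type) [arith.Structure A], IsRobinson A →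
    ∀ v : α → ℕ, φ.Realize (num A ∘ v) ↔ R v

namespace IsTermFn

theorem var (a : α) : IsTermFn fun v => v a :=
  ⟨Term.var a, fun _ _ _ _ => rfl⟩

theorem const (n : ℕ) : IsTermFn fun _ : α → ℕ => n := by
  induction n with
  | zero => exact ⟨tZero, fun A _ _ v => realize_tZero _⟩
  | succ n ih =>
    obtain ⟨t, ht⟩ := ih
    exact ⟨tSucc t, fun A _ hA v => by rw [realize_tSucc, ht A hA, num]⟩

variable {f g : (α → ℕ) → ℕ}

theorem add (hf : IsTermFn f) (hg : IsTermFn g) : IsTermFn fun v => f v + g v := by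
  obtain ⟨s, hs⟩ := hf
  obtain ⟨t, ht⟩ := hg
  exact ⟨tAdd s t, fun A _ hA v => by rw [realize_tAdd, hs A hA, ht A hA, hA.add_num]⟩

theorem mul (hf : IsTermFn f) (hg : IsTermFn g) : IsTermFn fun v => f v * g v := by
  obtain ⟨s, hs⟩ := hf
  obtain ⟨t, ht⟩ := hg
  exact ⟨tMul s t, fun A _ hA v => by rw [realize_tMul, hs A hA, ht A hA, hA.mul_num]⟩

theorem relabel (hf : IsTermFn f) (r : α → β) : IsTermFn fun v => f fun a => v (r a) := by
  obtain ⟨t, ht⟩ := hf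
  exact ⟨t.relabel r, fun A _ hA v => by rw [Term.realize_relabel, ← ht A hA]; rfl⟩

theorem succ (hf : IsTermFn f) : IsTermFn fun v => f v + 1 := hf.add (const 1)

end IsTermFn

namespace Binumerable

variable {R S : (α → ℕ) → Prop} {f g h : (α → ℕ) → ℕ}

theorem of_iff (hR : Binumerable R) (h : ∀ v, S v ↔ R v) : Binumerable S := by
  rwa [show S = R from funext fun v => propext (h v)]

theorem eq (hf : IsTermFn f) (hg : IsTermFn g) : Binumerable fun v => f v = g v := by
  obtain ⟨s, hs⟩ := hf
  obtain ⟨t, ht⟩ := hg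
  exact ⟨s.equal t, fun A _ hA v => by
    rw [Formula.realize_equal, hs A hA, ht A hA, hA.num_injective.eq_iff]⟩

theorem lt (hf : IsTermFn f) (hg : IsTermFn g) : Binumerable fun v => f v < g v := by
  obtain ⟨s, hs⟩ := hf
  obtain ⟨t, ht⟩ := hg
  refine ⟨ltFormula s t, fun A _ hA v => ?_⟩
  rw [realize_ltFormula, hs A hA, ht A hA, hA.lt_num_iff]
  simp only [hA.num_injective.eq_iff, exists_eq_right']

theorem not (hR : Binumerable R) : Binumerable fun v => ¬R v := by
  obtain ⟨φ, hφ⟩ := hR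
  exact ⟨φ.not, fun A _ hA v => by rw [Formula.realize_not, hφ A hA]⟩

theorem and (hR : Binumerable R) (hS : Binumerable S) : Binumerable fun v => R v ∧ S v := by
  obtain ⟨φ, hφ⟩ := hR
  obtain ⟨ψ, hψ⟩ := hS
  exact ⟨φ ⊓ ψ, fun A _ hA v => by rw [Formula.realize_inf, hφ A hA, hψ A hA]⟩

theorem or (hR : Binumerable R) (hS : Binumerable S) : Binumerable fun v => R v ∨ S v :=
  (hR.not.and hS.not).not.of_iff fun _ => or_iff_not_and_not

theorem subst {R : (β → ℕ) → Prop} (hR : Binumerable R) {f : β → (α → ℕ) → ℕ}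
    (hf : ∀ b, IsTermFn (f b)) : Binumerable fun v => R fun b => f b v := by
  obtain ⟨φ, hφ⟩ := hR
  choose t ht using hf
  refine ⟨BoundedFormula.subst φ t, fun A _ hA v => ?_⟩
  refine Iff.trans ?_ (hφ A hA fun b => f b v)
  rw [Formula.Realize, BoundedFormula.realize_subst]
  simp only [ht _ A hA]
  rfl

theorem bex {P : ℕ → (α → ℕ) → Prop}
    (hP : Binumerable fun w : Option α → ℕ => P (w none) fun a => w (some a)) (hf : IsTermFn f) :
    Binumerable fun v => ∃ i < f v, P i v := by
  obtain ⟨φ, hφ⟩ := hP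
  obtain ⟨t, ht⟩ := hf
  refine ⟨exNoneLT t φ, fun A _ hA v => ?_⟩
  rw [realize_exNoneLT, ht A hA]
  constructor
  · rintro ⟨x, hx, hφx⟩
    obtain ⟨i, hi, rfl⟩ := hA.lt_num_iff.1 hx
    exact ⟨i, hi, (hφ A hA (Option.elim · i v)).1 (by rwa [num_comp_elim])⟩
  · rintro ⟨i, hi, hPi⟩
    refine ⟨num A i, hA.num_lt_num hi, ?_⟩
    rw [← num_comp_elim]
    exact (hφ A hA _).2 hPi

theorem ball {P : ℕ → (α → ℕ) → Prop}
    (hP : Binumerable fun w : Option α → ℕ => P (w none) fun a => w (some a)) (hf : IsTermFn f) :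
    Binumerable fun v => ∀ i < f v, P i v :=
  (bex (P := fun i v => ¬P i v) hP.not hf).not.of_iff fun _ => by push Not; rfl

theorem eq_pair (hf : IsTermFn f) (hg : IsTermFn g) (hh : IsTermFn h) :
    Binumerable fun v => h v = Nat.pair (f v) (g v) := by
  refine (((lt hf hg).and (eq hh ((hg.mul hg).add hf))).or
    ((lt hf hg).not.and (eq hh (((hf.mul hf).add hf).add hg)))).of_iff fun v => ?_
  rw [Nat.pair]
  split_ifs with hc <;> simp [hc]

theorem mod_succ_eq (hf : IsTermFn f) (hg : IsTermFn g) (hh : IsTermFn h) :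
    Binumerable fun v => f v % (g v + 1) = h v := by
  refine ((lt hh hg.succ).and (bex (P := fun q v => f v = (g v + 1) * q + h v)
    (eq (hf.relabel some) (((hg.relabel some).succ.mul (.var none)).add (hh.relabel some)))
    hf.succ)).of_iff fun v => ⟨fun h => ?_, ?_⟩
  · exact h ▸ ⟨Nat.mod_lt _ (Nat.succ_pos _), f v / (g v + 1),
      Nat.lt_succ_of_le (Nat.div_le_self _ _), (Nat.div_add_mod _ _).symm⟩
  · rintro ⟨hlt, q, _, hq⟩
    rw [hq, Nat.mul_add_mod, Nat.mod_eq_of_lt hlt]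

theorem swap {P : ℕ → (Option α → ℕ) → Prop}
    (hP : Binumerable fun w : Option (Option α) → ℕ => P (w none) fun o => w (some o)) :
    Binumerable fun w : Option (Option α) → ℕ =>
      P (w (some none)) (Option.elim · (w none) fun a => w (some (some a))) := by
  refine (hP.subst (f := fun o w => o.elim (w (some none))
    (Option.elim · (w none) fun a => w (some (some a)))) ?_)
  rintro (_ | _ | a)
  exacts [.var _, .var _, .var _]

end Binumerable

/-! ### Existential relations -/

/-- Projections of binumerable relations. The bound `s` in the encoding is an upper bound for all
the witnesses at once, whence the monotonicity. -/
def Existential (R : (α → ℕ) → Prop) : Prop :=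
  ∃ P : ℕ → (α → ℕ) → Prop,
    (Binumerable fun w : Option α → ℕ => P (w none) fun a => w (some a)) ∧
      (∀ v, Monotone (P · v)) ∧ ∀ v, R v ↔ ∃ s, P s v

theorem exists_iff_eventually_of_monotone {p : ℕ → Prop} (hp : Monotone p) :
    (∃ s, p s) ↔ ∀ᶠ s in atTop, p s :=
  ⟨fun ⟨s, hs⟩ => (eventually_ge_atTop s).mono fun _ hst => hp hst hs, Eventually.exists⟩

namespace Existential

variable {R S : (α → ℕ) → Prop} {f g h : (α → ℕ) → ℕ}

theorem of_iff (hR : Existential R) (h : ∀ v, S v ↔ R v) : Existential S := by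
  rwa [show S = R from funext fun v => propext (h v)]

theorem of_binumerable (hR : Binumerable R) : Existential R :=
  ⟨fun _ v => R v, hR.subst fun b => .var (some b), fun _ => monotone_const,
    fun _ => exists_const ℕ |>.symm⟩

theorem subst {R : (β → ℕ) → Prop} (hR : Existential R) {f : β → (α → ℕ) → ℕ}
    (hf : ∀ b, IsTermFn (f b)) : Existential fun v => R fun b => f b v := by
  obtain ⟨P, hP, hmono, hRP⟩ := hR
  refine ⟨fun s v => P s fun b => f b v, ?_, fun v => hmono _, fun v => hRP _⟩
  refine hP.subst (f := fun o w => o.elim (w none) fun b => f b fun a => w (some a)) ?_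
  rintro (_ | b)
  exacts [.var none, (hf b).relabel some]

theorem and (hR : Existential R) (hS : Existential S) : Existential fun v => R v ∧ S v := by
  obtain ⟨P, hP, hPm, hRP⟩ := hR
  obtain ⟨Q, hQ, hQm, hSQ⟩ := hS
  have hmono (v : α → ℕ) : Monotone fun s => P s v ∧ Q s v :=
    fun _ _ hst => And.imp (hPm v hst) (hQm v hst)
  refine ⟨fun s v => P s v ∧ Q s v, hP.and hQ, hmono, fun v => ?_⟩
  simp only [exists_iff_eventually_of_monotone (hmono v), eventually_and, hRP, hSQ,
    exists_iff_eventually_of_monotone (hPm v), exists_iff_eventually_of_monotone (hQm v)]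

variable {P : ℕ → (α → ℕ) → Prop}

theorem ex (hP : Existential fun w : Option α → ℕ => P (w none) fun a => w (some a)) :
    Existential fun v => ∃ i, P i v := by
  obtain ⟨Q, hQ, hQm, hPQ⟩ := hP
  have hPQ' (i v) : P i v ↔ ∃ s, Q s (Option.elim · i v) := hPQ (Option.elim · i v)
  refine ⟨fun s v => ∃ i < s, Q s (Option.elim · i v), Binumerable.bex
    (P := fun i w => Q (w none) (Option.elim · i fun a => w (some a))) hQ.swap (.var none),
    fun v s t hst ⟨i, hi, h⟩ => ⟨i, hi.trans_le hst, hQm _ hst h⟩, fun v => ?_⟩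
  simp only [hPQ']
  refine ⟨fun ⟨i, s, h⟩ => ?_, fun ⟨s, i, _, h⟩ => ⟨i, s, h⟩⟩
  exact ⟨max (i + 1) s, i, le_max_left (i + 1) s, hQm _ (le_max_right _ _) h⟩

theorem ball (hP : Existential fun w : Option α → ℕ => P (w none) fun a => w (some a))
    (hf : IsTermFn f) : Existential fun v => ∀ i < f v, P i v := by
  obtain ⟨Q, hQ, hQm, hPQ⟩ := hP
  have hPQ' (i v) : P i v ↔ ∃ s, Q s (Option.elim · i v) := hPQ (Option.elim · i v)
  have hmono (v : α → ℕ) : Monotone fun s => ∀ i < f v, Q s (Option.elim · i v) :=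
    fun s t hst h i hi => hQm _ hst (h i hi)
  refine ⟨fun s v => ∀ i < f v, Q s (Option.elim · i v), Binumerable.ball
    (P := fun i w => Q (w none) (Option.elim · i fun a => w (some a))) hQ.swap (hf.relabel some),
    hmono, fun v => ?_⟩
  rw [exists_iff_eventually_of_monotone (hmono v)]
  refine Iff.trans ?_ (eventually_all_finite (Set.finite_Iio (f v))).symm
  simp only [hPQ', exists_iff_eventually_of_monotone (hQm _), Set.mem_Iio]

theorem eq (hf : IsTermFn f) (hg : IsTermFn g) : Existential fun v => f v = g v :=
  of_binumerable (.eq hf hg)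

theorem eq_pair (hf : IsTermFn f) (hg : IsTermFn g) (hh : IsTermFn h) :
    Existential fun v => h v = Nat.pair (f v) (g v) :=
  of_binumerable (.eq_pair hf hg hh)

theorem eq_beta (hf : IsTermFn f) (hg : IsTermFn g) (hh : IsTermFn h) :
    Existential fun v => h v = Nat.beta (f v) (g v) := by
  refine (ex (P := fun p v => ∃ q, f v = Nat.pair p q ∧ p % ((g v + 1) * q + 1) = h v)
    (ex (and (eq_pair (.var _) (.var none) ((hf.relabel some).relabel some))
      (of_binumerable (.mod_succ_eq (.var _)
        (((hg.relabel some).relabel some).succ.mul (.var none))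
        ((hh.relabel some).relabel some)))))).of_iff fun v => ?_
  constructor
  · exact fun h => ⟨_, _, (Nat.pair_unpair _).symm, h.symm⟩
  · rintro ⟨p, q, hpq, h⟩
    rw [hpq, Nat.beta, Nat.unpair_pair, h]

theorem exists_separating_formula (hR : Existential R) (hS : Existential S)
    (hdisj : ∀ v, R v → ¬S v) :
    ∃ φ : arith.Formula α, ∀ (A : Type) [arith.Structure A], IsRobinson A → ∀ v : α → ℕ,
      (R v → φ.Realize (num A ∘ v)) ∧ (S v → ¬φ.Realize (num A ∘ v)) := by
  obtain ⟨P, ⟨φ, hφ⟩, -, hRP⟩ := hR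
  obtain ⟨Q, ⟨ψ, hψ⟩, -, hSQ⟩ := hS
  refine ⟨exNone (φ ⊓ (exNoneLT (Term.var none)
    (ψ.relabel fun o => o.elim none fun a => some (some a))).not), fun A _ hA v => ?_⟩
  have hval (x y : A) : ((Option.elim · y (Option.elim · x (num A ∘ v))) ∘
      fun o : Option α => o.elim none fun a => some (some a)) = (Option.elim · y (num A ∘ v)) :=
    funext fun o => by cases o <;> rfl
  have hφv (s) : φ.Realize (Option.elim · (num A s) (num A ∘ v)) ↔ P s v := by
    rw [← num_comp_elim]; exact hφ A hA _
  have hψv (s) : ψ.Realize (Option.elim · (num A s) (num A ∘ v)) ↔ Q s v := by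
    rw [← num_comp_elim]; exact hψ A hA _
  simp only [realize_exNone, Formula.realize_inf, Formula.realize_not, realize_exNoneLT,
    Formula.realize_relabel, hval, Term.realize_var, Option.elim_none]
  constructor
  · intro hRv
    obtain ⟨s, hs⟩ := (hRP v).1 hRv
    refine ⟨num A s, (hφv s).2 hs, ?_⟩
    rintro ⟨y, hy, hψy⟩
    obtain ⟨t, -, rfl⟩ := hA.lt_num_iff.1 hy
    exact hdisj v hRv ((hSQ v).2 ⟨t, (hψv t).1 hψy⟩)
  · rintro hSv ⟨x, hφx, hno⟩
    obtain ⟨t, ht⟩ := (hSQ v).1 hSv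
    rcases hA.lt_num_succ_or_num_lt t x with hlt | hlt
    · obtain ⟨s, -, rfl⟩ := hA.lt_num_iff.1 hlt
      exact hdisj v ((hRP v).2 ⟨s, (hφv s).1 hφx⟩) hSv
    · exact hno ⟨num A t, hlt, (hψv t).2 ht⟩

end Existential

end Binumerable

/-! ### Graphs of partial recursive functions -/

/-- Partial functions whose graph is an existential relation. -/
def ExistentialGraph (f : ℕ →. ℕ) : Prop :=
  Existential fun v : Fin 2 → ℕ => v 1 ∈ f (v 0)

theorem exists_beta_sequence (s : ℕ → ℕ) (n : ℕ) : ∃ c, ∀ i ≤ n, s i = Nat.beta c i := by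
  refine ⟨Nat.unbeta (List.ofFn fun i : Fin (n + 1) => s i), fun i hi => ?_⟩
  have hlt : i < (List.ofFn fun i : Fin (n + 1) => s i).length := by
    rwa [List.length_ofFn, Nat.lt_succ_iff]
  exact ((Nat.beta_unbeta_coe _ ⟨i, hlt⟩).trans (List.getElem_ofFn hlt)).symm

theorem mem_prec_iff_exists_sequence {f g : ℕ →. ℕ} {a n y : ℕ} :
    y ∈ (Nat.rec (f a) (fun y IH => do let i ← IH; g (Nat.pair a (Nat.pair y i))) n : Part ℕ) ↔
      ∃ s : ℕ → ℕ, s 0 ∈ f a ∧ (∀ i < n, s (i + 1) ∈ g (Nat.pair a (Nat.pair i (s i)))) ∧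
        y = s n := by
  induction n generalizing y with
  | zero => exact ⟨fun h => ⟨fun _ => y, h, nofun, rfl⟩, fun ⟨_, h0, _, hy⟩ => hy ▸ h0⟩
  | succ n ih =>
    simp only [Part.bind_eq_bind, Part.mem_bind_iff] at ih ⊢
    constructor
    · rintro ⟨_, hi, hy⟩
      obtain ⟨s, h0, hs, rfl⟩ := ih.1 hi
      have hne {i : ℕ} (hi : i < n + 1) : Function.update s (n + 1) y i = s i :=
        Function.update_of_ne hi.ne _ _
      refine ⟨Function.update s (n + 1) y, ?_, fun i hi => ?_, by rw [Function.update_self]⟩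
      · rwa [hne n.succ_pos]
      · rw [hne hi]
        rcases Nat.lt_succ_iff_lt_or_eq.1 hi with h | rfl
        · rw [hne (Nat.succ_lt_succ h)]
          exact hs i h
        · rwa [Function.update_self]
    · rintro ⟨s, h0, hs, rfl⟩
      exact ⟨s n, ih.2 ⟨s, h0, fun i hi => hs i (hi.trans n.lt_succ_self), rfl⟩,
        hs n n.lt_succ_self⟩

namespace ExistentialGraph

variable {f g : ℕ →. ℕ}

theorem mem_apply (hf : ExistentialGraph f) {α : Type} {a b : (α → ℕ) → ℕ} (ha : IsTermFn a)
    (hb : IsTermFn b) : Existential fun v => b v ∈ f (a v) :=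
  Existential.subst (f := ![a, b]) hf (Fin.forall_fin_two.2 ⟨ha, hb⟩)

theorem of_existential {R : ℕ → ℕ → Prop} (hR : Existential fun v : Fin 2 → ℕ => R (v 0) (v 1))
    (h : ∀ x y, y ∈ f x ↔ R x y) : ExistentialGraph f :=
  hR.of_iff fun v => h (v 0) (v 1)

theorem zero : ExistentialGraph (pure 0) :=
  of_existential (R := fun _ y => y = 0) (.eq (.var _) (.const 0)) fun _ _ => Part.mem_some_iff

theorem succ : ExistentialGraph Nat.succ :=
  of_existential (R := fun x y => y = x + 1) (.eq (.var _) (.succ (.var _)))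
    fun _ _ => Part.mem_some_iff

theorem left : ExistentialGraph fun n : ℕ => n.unpair.1 :=
  of_existential (R := fun x y => ∃ z, x = Nat.pair y z)
    (.ex (.eq_pair (.var _) (.var _) (.var _))) fun x _ => Part.mem_some_iff.trans
      ⟨fun h => ⟨x.unpair.2, h ▸ (Nat.pair_unpair x).symm⟩,
        fun ⟨_, h⟩ => by rw [h, Nat.unpair_pair]⟩

theorem right : ExistentialGraph fun n : ℕ => n.unpair.2 :=
  of_existential (R := fun x y => ∃ z, x = Nat.pair z y)
    (.ex (.eq_pair (.var _) (.var _) (.var _))) fun x _ => Part.mem_some_iff.trans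
      ⟨fun h => ⟨x.unpair.1, h ▸ (Nat.pair_unpair x).symm⟩,
        fun ⟨_, h⟩ => by rw [h, Nat.unpair_pair]⟩

theorem pair (hf : ExistentialGraph f) (hg : ExistentialGraph g) :
    ExistentialGraph fun n => Nat.pair <$> f n <*> g n :=
  of_existential (R := fun x y => ∃ a b, a ∈ f x ∧ b ∈ g x ∧ y = Nat.pair a b)
    (.ex (.ex ((hf.mem_apply (.var _) (.var _)).and ((hg.mem_apply (.var _) (.var _)).and
      (.eq_pair (.var _) (.var _) (.var _))))))
    fun x y => by simp [Seq.seq, eq_comm]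

theorem comp (hf : ExistentialGraph f) (hg : ExistentialGraph g) :
    ExistentialGraph fun n => g n >>= f :=
  of_existential (R := fun x y => ∃ z, z ∈ g x ∧ y ∈ f z)
    (.ex ((hg.mem_apply (.var _) (.var _)).and (hf.mem_apply (.var _) (.var _))))
    fun _ _ => Part.mem_bind_iff

theorem prec (hf : ExistentialGraph f) (hg : ExistentialGraph g) :
    ExistentialGraph (Nat.unpaired fun a n =>
      n.rec (f a) fun y IH => do let i ← IH; g (Nat.pair a (Nat.pair y i))) := by
  refine of_existential (R := fun x y => ∃ a n c, x = Nat.pair a n ∧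
    (∃ z, z = Nat.beta c 0 ∧ z ∈ f a) ∧
    (∀ i < n, ∃ z z' u w, z = Nat.beta c i ∧ z' = Nat.beta c (i + 1) ∧ u = Nat.pair i z ∧
      w = Nat.pair a u ∧ z' ∈ g w) ∧
    y = Nat.beta c n) ?_ fun x y => ?_
  · exact .ex <| .ex <| .ex <| .and (.eq_pair (.var _) (.var _) (.var _)) <|
      .and (.ex <| .and (.eq_beta (.var _) (.const 0) (.var _))
        (hf.mem_apply (.var _) (.var _))) <|
      .and (.ball (.ex <| .ex <| .ex <| .ex <| .and (.eq_beta (.var _) (.var _) (.var _)) <|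
        .and (.eq_beta (.var _) (.succ (.var _)) (.var _)) <|
        .and (.eq_pair (.var _) (.var _) (.var _)) <|
        .and (.eq_pair (.var _) (.var _) (.var _)) (hg.mem_apply (.var _) (.var _))) (.var _)) <|
      .eq_beta (.var _) (.var _) (.var _)
  · rw [Nat.unpaired, mem_prec_iff_exists_sequence]
    constructor
    · rintro ⟨s, h0, hs, rfl⟩
      obtain ⟨c, hc⟩ := exists_beta_sequence s x.unpair.2
      exact ⟨_, _, c, (Nat.pair_unpair x).symm, ⟨_, hc 0 (Nat.zero_le _), h0⟩,
        fun i hi => ⟨_, _, _, _, hc i hi.le, hc (i + 1) hi, rfl, rfl, hs i hi⟩, hc _ le_rfl⟩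
    · rintro ⟨a, n, c, rfl, ⟨_, rfl, h0⟩, hs, rfl⟩
      rw [Nat.unpair_pair]
      refine ⟨Nat.beta c, h0, fun i hi => ?_, rfl⟩
      obtain ⟨_, _, _, _, rfl, rfl, rfl, rfl, h⟩ := hs i hi
      exact h

theorem rfind (hf : ExistentialGraph f) :
    ExistentialGraph fun a => Nat.rfind fun n => (fun m => m = 0) <$> f (Nat.pair a n) := by
  refine of_existential (R := fun x y => (∃ z, z = Nat.pair x y ∧ 0 ∈ f z) ∧
    ∀ i < y, ∃ z w, z = Nat.pair x i ∧ w + 1 ∈ f z) ?_ fun x y => ?_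
  · exact .and
      (.ex (.and (.eq_pair (.var _) (.var _) (.var _)) (hf.mem_apply (.var _) (.const 0))))
      (.ball (.ex (.ex (.and (.eq_pair (.var _) (.var _) (.var _))
        (hf.mem_apply (.var _) (.succ (.var _)))))) (.var _))
  · refine Nat.mem_rfind.trans (and_congr ?_ (forall₂_congr fun i _ => ?_))
    · refine (Part.mem_map_iff _).trans ⟨?_, ?_⟩
      · rintro ⟨w, hw, h0⟩
        exact ⟨_, rfl, of_decide_eq_true h0 ▸ hw⟩
      · rintro ⟨_, rfl, h0⟩
        exact ⟨0, h0, rfl⟩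
    · refine (Part.mem_map_iff _).trans ⟨?_, ?_⟩
      · rintro ⟨w, hw, h0⟩
        obtain ⟨w, rfl⟩ := Nat.exists_eq_succ_of_ne_zero (of_decide_eq_false h0)
        exact ⟨_, w, rfl, hw⟩
      · rintro ⟨_, w, rfl, hw⟩
        exact ⟨w + 1, hw, rfl⟩

theorem of_partrec (hf : Nat.Partrec f) : ExistentialGraph f := by
  induction hf with
  | zero => exact zero
  | succ => exact succ
  | left => exact left
  | right => exact right
  | pair _ _ hf hg => exact hf.pair hg
  | comp _ _ hf hg => exact hf.comp hg
  | prec _ _ hf hg => exact hf.prec hg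
  | rfind _ hf => exact hf.rfind

end ExistentialGraph

theorem exists_deciding_formula {f : ℕ →. Bool} (hf : Partrec f) :
    ∃ φ : arith.Formula (Fin 1), ∀ (A : Type) [arith.Structure A], IsRobinson A →
      ∀ n, ∀ b ∈ f n, (φ.Realize (fun _ => num A n) ↔ b = true) := by
  have htoNat : Computable₂ fun (_ : ℕ) (b : Bool) => b.toNat :=
    (Primrec.dom_finite Bool.toNat).to_comp.comp Computable.snd
  have htoNat_inj {b c : Bool} (h : b.toNat = c.toNat) : b = c := by
    rw [← Bool.ofNat_toNat b, h, Bool.ofNat_toNat]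
  have hgraph (b : Bool) : Existential fun v : Fin 1 → ℕ => b ∈ f (v 0) :=
    ((ExistentialGraph.of_partrec (Partrec.nat_iff.1 (hf.map htoNat))).mem_apply (.var 0)
      (.const b.toNat)).of_iff fun v =>
        ((Part.mem_map_iff _).trans
          ⟨fun ⟨_, hb, h⟩ => htoNat_inj h ▸ hb, fun hb => ⟨b, hb, rfl⟩⟩).symm
  obtain ⟨φ, hφ⟩ := (hgraph true).exists_separating_formula (hgraph false)
    fun v ht hf => Bool.noConfusion (Part.mem_unique ht hf)
  refine ⟨φ, fun A _ hA n b hb => ?_⟩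
  obtain ⟨htrue, hfalse⟩ := hφ A hA fun _ => n
  cases b with
  | true => exact iff_of_true (htrue hb) rfl
  | false => exact iff_of_false (hfalse hb) Bool.false_ne_true

/-! ### Gödel numbers -/

theorem codeFunc_injective {k l : ℕ} {f : ArithFunc k} {g : ArithFunc l} {c : Fin k → ℕ}
    {d : Fin l → ℕ} (h : codeFunc f c = codeFunc g d) : k = l ∧ HEq f g ∧ HEq c d := by
  cases f <;> cases g <;> simp_all [codeFunc, funext_iff, Fin.forall_fin_two]

theorem codeTerm_injective {n : ℕ} :
    Function.Injective (codeTerm : arith.Term (Empty ⊕ Fin n) → ℕ) := by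
  have hne {k : ℕ} (f : ArithFunc k) (c : Fin k → ℕ) (i : Fin n) :
      Nat.pair 0 i ≠ codeFunc f c := by
    cases f <;> simp [codeFunc]
  intro t
  induction t with
  | var a =>
    rintro ((⟨⟨⟩⟩ | j) | ⟨g, us⟩) h
    · rcases a with ⟨⟨⟩⟩ | i
      rw [codeTerm, codeTerm, Nat.pair_eq_pair] at h
      rw [Fin.ext h.2]
    · rcases a with ⟨⟨⟩⟩ | i
      exact absurd h (hne _ _ _)
  | func f ts ih =>
    rintro ((⟨⟨⟩⟩ | j) | ⟨g, us⟩) h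
    · exact absurd h.symm (hne _ _ _)
    · obtain ⟨rfl, hfg, hts⟩ := codeFunc_injective h
      obtain rfl := eq_of_heq hfg
      exact congrArg _ (funext fun i => ih i (congrFun (eq_of_heq hts) i))

theorem codeFormula_injective {n : ℕ} :
    Function.Injective (codeFormula : arith.BoundedFormula Empty n → ℕ) := by
  intro φ
  induction φ with
  | rel R => exact Empty.elim R
  | falsum =>
    rintro (_ | _ | R | _ | _) h
    case falsum => rfl
    case rel => exact Empty.elim R
    all_goals simp [codeFormula] at h
  | equal t s =>
    rintro (_ | ⟨t', s'⟩ | R | _ | _) h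
    case equal =>
      simp only [codeFormula, Nat.pair_eq_pair, true_and] at h
      rw [codeTerm_injective h.1, codeTerm_injective h.2]
    case rel => exact Empty.elim R
    all_goals simp [codeFormula] at h
  | imp φ₁ φ₂ ih₁ ih₂ =>
    rintro (_ | _ | R | ⟨ψ₁, ψ₂⟩ | _) h
    case imp =>
      simp only [codeFormula, Nat.pair_eq_pair, true_and] at h
      rw [ih₁ h.1, ih₂ h.2]
    case rel => exact Empty.elim R
    all_goals simp [codeFormula] at h
  | all φ ih =>
    rintro (_ | _ | R | _ | ψ) h
    case all =>
      simp only [codeFormula, Nat.pair_eq_pair, true_and] at h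
      rw [ih h]
    case rel => exact Empty.elim R
    all_goals simp [codeFormula] at h

/-- The numeral `S ⋯ S 0` as a term. -/
def tNum {α : Type} : ℕ → arith.Term α
  | 0 => tZero
  | n + 1 => tSucc (tNum n)

theorem realize_tNum {α : Type} {A : Type*} [arith.Structure A] (v : α → A) (n : ℕ) :
    (tNum n : arith.Term α).realize v = num A n := by
  induction n with
  | zero => exact realize_tZero v
  | succ n ih => rw [tNum, realize_tSucc, ih, num]

/-- The sentence `∀ x, x = n → φ(x)`, which expresses `φ(n)`: unlike the code of the result of
substituting the numeral for `n` in `φ`, its code depends on `n` in an explicit way. -/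
def instanceAt (φ : arith.Formula (Fin 1)) (n : ℕ) : arith.Sentence :=
  closure (((Term.var 0).equal (tNum n)).imp φ)

theorem realize_instanceAt {A : Type*} [arith.Structure A] {φ : arith.Formula (Fin 1)} {n : ℕ} :
    A ⊨ instanceAt φ n ↔ φ.Realize fun _ => num A n := by
  simp only [instanceAt, realize_closure, Formula.realize_imp, Formula.realize_equal,
    realize_tNum, Term.realize_var]
  refine ⟨fun h => h (fun _ => num A n) rfl, fun h xs hxs => ?_⟩
  rwa [show xs = fun _ => num A n from funext fun i => Subsingleton.elim 0 i ▸ hxs]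

theorem relabel_tNum {α β : Type} (r : α → β) (n : ℕ) :
    (tNum n : arith.Term α).relabel r = tNum n := by
  induction n with
  | zero => exact congrArg (Term.func (L := arith) ArithFunc.zero) (Subsingleton.elim _ _)
  | succ n ih =>
    rw [tNum, tNum, ← ih]
    exact congrArg (Term.func (L := arith) ArithFunc.succ) (funext fun i => by fin_cases i; rfl)

theorem primrec_codeTerm_tNum (m : ℕ) :
    Primrec fun n => codeTerm (tNum n : arith.Term (Empty ⊕ Fin m)) := by
  have hsucc : Primrec₂ fun _ c : ℕ => Nat.pair 2 c :=
    Primrec₂.natPair.comp (Primrec.const 2) Primrec.snd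
  refine (Primrec.nat_rec₁ (Nat.pair 1 0) hsucc).of_eq fun n => ?_
  induction n with
  | zero => rfl
  | succ n ih => exact congrArg (Nat.pair 2) ih

theorem godelNumber_instanceAt (φ : arith.Formula (Fin 1)) (n : ℕ) :
    godelNumber (instanceAt φ n) = Nat.pair 3 (Nat.pair 2 (Nat.pair
      (Nat.pair 1 (Nat.pair (Nat.pair 0 0) (codeTerm (tNum n : arith.Term (Empty ⊕ Fin 1)))))
      (codeFormula (BoundedFormula.relabel (Sum.inr : Fin 1 → Empty ⊕ Fin 1) φ)))) := by
  change Nat.pair 3 (Nat.pair 2 (Nat.pair (Nat.pair 1 (Nat.pair _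
    (codeTerm (((tNum n).relabel _).relabel _)))) _)) = _
  rw [relabel_tNum, relabel_tNum]
  rfl

theorem computable_godelNumber_instanceAt (φ : arith.Formula (Fin 1)) :
    Computable fun n => godelNumber (instanceAt φ n) := by
  simp only [godelNumber_instanceAt]
  exact (Primrec₂.natPair.comp (Primrec.const 3) (Primrec₂.natPair.comp (Primrec.const 2)
    (Primrec₂.natPair.comp (Primrec₂.natPair.comp (Primrec.const 1)
      (Primrec₂.natPair.comp (Primrec.const _) (primrec_codeTerm_tNum 1)))
      (Primrec.const _)))).to_comp

/-- The class of (characteristic functions of the sets of Gödel numbers of) consistent completions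
of a theory of arithmetic, so that `consistentCompletionsPA` is the case of `peano`. -/
def consistentCompletions (T : arith.Theory) : Set (ℕ → Bool) :=
  {X | ∃ T' : arith.Theory, T ⊆ T' ∧ T'.IsMaximal ∧
    ∀ k, X k = true ↔ ∃ φ ∈ T', godelNumber φ = k}

theorem exists_model_of_mem_consistentCompletions {T : arith.Theory} {X : ℕ → Bool}
    (hX : X ∈ consistentCompletions T) : ∃ (A : Type) (_ : arith.Structure A),
      A ⊨ T ∧ ∀ φ : arith.Sentence, X (godelNumber φ) = true ↔ A ⊨ φ := by
  obtain ⟨T', hT, ⟨⟨A⟩, hmax⟩, hX⟩ := hX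
  have hA : ∀ φ ∈ T', A ⊨ φ := fun φ hφ => Theory.realize_sentence_of_mem T' hφ
  refine ⟨A, inferInstance, ⟨fun φ hφ => hA φ (hT hφ)⟩, fun φ => ?_⟩
  rw [hX]
  constructor
  · rintro ⟨ψ, hψ, h⟩
    exact codeFormula_injective h ▸ hA ψ hψ
  · exact fun h => ⟨φ, (hmax φ).resolve_right fun hn => (Sentence.realize_not A).1 (hA _ hn) h, rfl⟩

theorem uniformlyExtends_consistentCompletions {T : arith.Theory}
    (hT : ∀ (A : Type) [arith.Structure A], A ⊨ T → IsRobinson A) {ψ : ℕ →. Bool}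
    (hψ : Partrec ψ) : UniformlyExtends (consistentCompletions T) ψ := by
  obtain ⟨φ, hφ⟩ := exists_deciding_formula hψ
  refine ⟨fun n => godelNumber (instanceAt φ n), computable_godelNumber_instanceAt φ,
    fun X hX n b hb => ?_⟩
  obtain ⟨A, _, hA, hXA⟩ := exists_model_of_mem_consistentCompletions hX
  rw [Function.comp_apply, Bool.eq_iff_iff, hXA, realize_instanceAt]
  exact hφ A (hT A hA) n b hb

end DeepClass

open DeepClass in
theorem mainTheorem7_general {φ : ℕ → ℕ →. Bool} (hφ : IsEffectiveEnumeration φ)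
    {u : ℕ →. Bool} (hu : IsUniversalFor u φ) {M : List Bool → ℝ}
    (hM : IsContinuousSemimeasure M) (hls : IsLowerSemicomputable M) {T : arith.Theory}
    (hT : ∀ (A : Type) [arith.Structure A], A ⊨ T → IsRobinson A) :
    IsPi01Class (totalExtensions u) ∧ IsDeep M (totalExtensions u) ∧
      IsDeep M (consistentCompletions T) :=
  ⟨isPi01Class_totalExtensions hu.partrec,
    isDeep_of_forall_uniformlyExtends hM hls fun _ => uniformlyExtends_totalExtensions hφ hu,
    isDeep_of_forall_uniformlyExtends hM hls fun _ => uniformlyExtends_consistentCompletions hT⟩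

theorem mainTheorem7
    (φ : ℕ → ℕ →. Bool) (hφ : DeepClass.IsEffectiveEnumeration φ)
    (u : ℕ →. Bool) (hu : DeepClass.IsUniversalFor u φ)
    (M : List Bool → ℝ) (hM : DeepClass.IsUniversalSemimeasure M) :
    DeepClass.IsPi01Class (DeepClass.totalExtensions u) ∧
      DeepClass.IsDeep M (DeepClass.totalExtensions u) ∧
      DeepClass.IsDeep M DeepClass.consistentCompletionsPA :=
  mainTheorem7_general hφ hu hM.semimeasure hM.lowerSemicomputable fun _ _ =>
    DeepClass.isRobinson_of_models_peano
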